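/- Let $\mathcal B$ be a braided monoidal category with braiding $c_{x,y}:x\otimes y\to y\otimes x$ which has equalizers and in which the intersection of any family of subobjects of any object exists (a subobject through which a morphism factors if and only if it factors through all members of the family). Let $\bar{\mathcal B}$ be the monoidal category $\mathcal B$ with the braiding $\bar c_{x,y}=c_{y,x}^{-1}$. Let $\mathcal C$ be a monoidal category with Drinfeld center $Z(\mathcal C)$, whose objects are pairs $(x,b_{x,-})$ with a half-braiding $b_{x,z}:x\otimes z\to z\otimes x$ and whose braiding is $b_{x,y}$. Let $\psi:\bar{\mathcal B}\to Z(\mathcal C)$ be a braided oplax monoidal functor whose structure morphism $\psi(\mathbf 1)\to\mathbf 1$ is an isomorphism, let $\phi:\mathcal B\to\mathcal C$ be its composite with the forgetful functor, and suppose that for every $x\in\mathcal C$ the functor $\phi(-)\otimes x:\mathcal B\to\mathcal C$ has a right adjoint $[x,-]:\mathcal C\to\mathcal B$, with counit $v_y:\phi[x,y]\otimes x\to y$. Let $\mathcal C^\sharp$ be the following monoidal category enriched over $\mathcal B$. Its objects are those of $\mathcal C$, and $\mathcal C^\sharp(x,y)=[x,y]$. The composition $[y,z]\otimes[x,y]\to[x,z]$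 is adjoint to $$\phi([y,z]\otimes[x,y])\otimes x\to\phi[y,z]\otimes\phi[x,y]\otimes x\xrightarrow{1\otimes v_y}\phi[y,z]\otimes y\xrightarrow{v_z}z,$$ the identity $\mathbf 1\to[x,x]$ is adjoint to $\phi(\mathbf 1)\otimes x\to x$, and the tensor product $[x,x']\otimes[y,y']\to[x\otimes y,x'\otimes y']$ is adjoint to $$\phi([x,x']\otimes[y,y'])\otimes x\otimes y\to\phi[x,x']\otimes\phi[y,y']\otimes x\otimes y\xrightarrow{1\otimes b_{\phi[y,y'],x}\otimes 1}\phi[x,x']\otimes x\otimes\phi[y,y']\otimes y\xrightarrow{v_{x'}\otimes v_{y'}}x'\otimes y'.$$ Here the composition in a product of enriched categories exchanges the two middle factors by $c^{-1}$. The morphisms $\mathbf 1\to[x,y]$ correspond to the morphisms $x\to y$ of $\mathcal C$, and the associator and unitors of $\mathcal C^\sharp$ are those of $\mathcal C$ under this correspondence. The Drinfeld center $Z(\mathcal C^\sharp)$ has as objects the pairs $(x,b_x)$ of an object $x$ and an enriched natural isomorphism $b_x:x\otimes-\to-\otimes x$ which is a half-braiding in the underlying monoidal category. Its hom object from $(x,b_x)$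 to $(y,b_y)$ is the intersection over all objects $z$ of the equalizers of the two morphisms $\mathcal C^\sharp(x,y)\rightrightarrows\mathcal C^\sharp(x\otimes z,z\otimes y)$ given by $z\otimes-$ followed by $-\circ b_{x,z}$, and by $-\otimes z$ followed by $b_{y,z}\circ-$; identities and composition are induced from $\mathcal C^\sharp$. The underlying category of an enriched category has as morphisms $x\to y$ the morphisms from $\mathbf 1$ to the hom object. The centralizer of $\bar{\mathcal B}$ in $Z(\mathcal C)$ is the full subcategory of $Z(\mathcal C)$ of the objects whose double braidings with all objects of the essential image of $\psi$ are trivial. Then: 1. The canonical functor from the underlying category of $Z(\mathcal C^\sharp)$ to $Z(\mathcal C)$, given by the correspondence between morphisms $\mathbf 1\to[x,y]$ and morphisms $x\to y$, takes values in the centralizer of $\bar{\mathcal B}$ in $Z(\mathcal C)$ and is an isomorphism of categories (fully faithful and bijective on objects) onto this centralizer. 2. For all $x,y\in Z(\mathcal C^\sharp)$, the hom object $Z(\mathcal C^\sharp)(x,y)$ represents the functor $Z(\mathcal C)(\psi(-)\otimes x,y):\mathcal B^{\mathrm{op}}\to\mathrm{Set}$; the representing bijection sends $f:w\to Z(\mathcal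 C^\sharp)(x,y)$ to the morphism $\phi(w)\otimes x\to y$ adjoint to $w\xrightarrow{f}Z(\mathcal C^\sharp)(x,y)\hookrightarrow[x,y]$. -/

import Mathlib

open CategoryTheory MonoidalCategory Limits

universe v₁ v₂ u₁ u₂ w₁ w₂ w₃ w₄

noncomputable section

namespace EnrichedCenter

section Basic

variable {B : Type u₁} [Category.{v₁} B] [MonoidalCategory B]

/-- A category enriched over `B` with objects `O`.  Composition is a morphism
`hom y z ⊗ hom x y ⟶ hom x z`.  Mathlib's `EnrichedCategory` uses the opposite order of the two
tensor factors; over a braided base that is not symmetric the two orders cannot be exchanged without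
also exchanging the base with its reverse, so the structure is written out here. -/
structure ECat (B : Type u₁) [Category.{v₁} B] [MonoidalCategory B] (O : Type w₁) where
  hom : O → O → B
  id (x : O) : 𝟙_ B ⟶ hom x x
  comp (x y z : O) : hom y z ⊗ hom x y ⟶ hom x z
  comp_id (x y : O) : (ρ_ (hom x y)).inv ≫ hom x y ◁ id x ≫ comp x x y = 𝟙 _
  id_comp (x y : O) : (λ_ (hom x y)).inv ≫ id y ▷ hom x y ≫ comp x y y = 𝟙 _
  assoc (x y z w : O) : hom z w ◁ comp x y z ≫ comp x z w =
    (α_ _ _ _).inv ≫ comp y z w ▷ hom x y ≫ comp x y w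

attribute [simp] ECat.comp_id ECat.id_comp

namespace ECat

variable {O : Type w₁} (𝒞 : ECat B O)

/-- The operation `f ∘ -` of composing with a morphism `f` of the underlying category. -/
def postcomp {y z : O} (f : 𝟙_ B ⟶ 𝒞.hom y z) (x : O) : 𝒞.hom x y ⟶ 𝒞.hom x z :=
  (λ_ _).inv ≫ f ▷ 𝒞.hom x y ≫ 𝒞.comp x y z

/-- The operation `- ∘ f` of composing with a morphism `f` of the underlying category. -/
def precomp {x y : O} (f : 𝟙_ B ⟶ 𝒞.hom x y) (z : O) : 𝒞.hom y z ⟶ 𝒞.hom x z :=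
  (ρ_ _).inv ≫ 𝒞.hom y z ◁ f ≫ 𝒞.comp x y z

/-- The objects of the underlying category. -/
@[ext]
structure Underlying (𝒞 : ECat B O) where
  obj : O

/-- Composition of morphisms `𝟙_ B ⟶ hom x y` and `𝟙_ B ⟶ hom y z`. -/
def ucomp {x y z : O} (f : 𝟙_ B ⟶ 𝒞.hom x y) (g : 𝟙_ B ⟶ 𝒞.hom y z) : 𝟙_ B ⟶ 𝒞.hom x z :=
  (λ_ (𝟙_ B)).inv ≫ (g ⊗ₘ f) ≫ 𝒞.comp x y z

lemma ucomp_eq_postcomp {x y z : O} (f : 𝟙_ B ⟶ 𝒞.hom x y) (g : 𝟙_ B ⟶ 𝒞.hom y z) :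
    𝒞.ucomp f g = f ≫ 𝒞.postcomp g x := by
  simp [ucomp, postcomp, tensorHom_def']

lemma ucomp_eq_precomp {x y z : O} (f : 𝟙_ B ⟶ 𝒞.hom x y) (g : 𝟙_ B ⟶ 𝒞.hom y z) :
    𝒞.ucomp f g = g ≫ 𝒞.precomp f z := by
  simp [ucomp, precomp, MonoidalCategory.tensorHom_def, unitors_inv_equal]

@[simp]
lemma postcomp_id (x y : O) : 𝒞.postcomp (𝒞.id y) x = 𝟙 _ := 𝒞.id_comp x y

@[simp]
lemma precomp_id (x y : O) : 𝒞.precomp (𝒞.id x) y = 𝟙 _ := 𝒞.comp_id x y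

lemma comp_postcomp {x y z w : O} (f : 𝟙_ B ⟶ 𝒞.hom z w) :
    𝒞.comp x y z ≫ 𝒞.postcomp f x = 𝒞.postcomp f y ▷ _ ≫ 𝒞.comp x y w := by
  simp only [postcomp, leftUnitor_inv_naturality_assoc, whisker_exchange_assoc, 𝒞.assoc]
  simp

lemma comp_precomp {x y z w : O} (f : 𝟙_ B ⟶ 𝒞.hom x y) :
    𝒞.comp y z w ≫ 𝒞.precomp f w = _ ◁ 𝒞.precomp f z ≫ 𝒞.comp x z w := by
  simp only [precomp, MonoidalCategory.whiskerLeft_comp, Category.assoc, 𝒞.assoc]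
  rw [rightUnitor_inv_naturality_assoc, ← whisker_exchange_assoc]
  simp

lemma precomp_comp {x y z w : O} (f : 𝟙_ B ⟶ 𝒞.hom y z) :
    𝒞.precomp f w ▷ 𝒞.hom x y ≫ 𝒞.comp x y w = _ ◁ 𝒞.postcomp f x ≫ 𝒞.comp x z w := by
  simp only [precomp, postcomp, MonoidalCategory.whiskerLeft_comp, Category.assoc, 𝒞.assoc]
  simp

lemma precomp_postcomp {x y z w : O} (f : 𝟙_ B ⟶ 𝒞.hom x y) (g : 𝟙_ B ⟶ 𝒞.hom z w) :
    𝒞.precomp f z ≫ 𝒞.postcomp g x = 𝒞.postcomp g y ≫ 𝒞.precomp f w := by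
  conv_lhs => rw [precomp, Category.assoc, Category.assoc, comp_postcomp,
    whisker_exchange_assoc, ← rightUnitor_inv_naturality_assoc]
  rfl

lemma postcomp_ucomp {x y z w : O} (f : 𝟙_ B ⟶ 𝒞.hom y z) (g : 𝟙_ B ⟶ 𝒞.hom z w) :
    𝒞.postcomp (𝒞.ucomp f g) x = 𝒞.postcomp f x ≫ 𝒞.postcomp g x := by
  conv_rhs => rw [postcomp, Category.assoc, Category.assoc, comp_postcomp]
  rw [ucomp_eq_postcomp, postcomp]
  simp

lemma precomp_ucomp {x y z w : O} (f : 𝟙_ B ⟶ 𝒞.hom x y) (g : 𝟙_ B ⟶ 𝒞.hom y z) :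
    𝒞.precomp (𝒞.ucomp f g) w = 𝒞.precomp g w ≫ 𝒞.precomp f w := by
  conv_rhs => rw [precomp, Category.assoc, Category.assoc, comp_precomp]
  rw [ucomp_eq_precomp, precomp]
  simp

/-- The underlying category: morphisms `x ⟶ y` are morphisms `𝟙_ B ⟶ hom x y` of `B`. -/
instance : Category 𝒞.Underlying where
  Hom X Y := 𝟙_ B ⟶ 𝒞.hom X.obj Y.obj
  id X := 𝒞.id X.obj
  comp f g := 𝒞.ucomp f g
  id_comp f := by rw [ucomp_eq_precomp, precomp_id, Category.comp_id]
  comp_id f := by rw [ucomp_eq_postcomp, postcomp_id, Category.comp_id]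
  assoc f g h := by rw [ucomp_eq_postcomp, ucomp_eq_postcomp, ucomp_eq_postcomp, postcomp_ucomp,
    Category.assoc]

end ECat

/-- Enriched functors. -/
structure EFunctor {O : Type w₁} {P : Type w₂} (𝒞 : ECat B O) (𝒟 : ECat B P) where
  obj : O → P
  map (x y : O) : 𝒞.hom x y ⟶ 𝒟.hom (obj x) (obj y)
  map_id (x : O) : 𝒞.id x ≫ map x x = 𝒟.id (obj x)
  map_comp (x y z : O) : 𝒞.comp x y z ≫ map x z =
    (map y z ⊗ₘ map x y) ≫ 𝒟.comp (obj x) (obj y) (obj z)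

namespace EFunctor

variable {O : Type w₁} {P : Type w₂} {Q : Type w₃} {𝒞 : ECat B O} {𝒟 : ECat B P} {ℰ : ECat B Q}

/-- The identity enriched functor. -/
protected def id (𝒞 : ECat B O) : EFunctor 𝒞 𝒞 where
  obj x := x
  map _ _ := 𝟙 _
  map_id _ := by simp
  map_comp _ _ _ := by simp

/-- Composition of enriched functors. -/
protected def comp (F : EFunctor 𝒞 𝒟) (G : EFunctor 𝒟 ℰ) : EFunctor 𝒞 ℰ where
  obj x := G.obj (F.obj x)
  map x y := F.map x y ≫ G.map _ _
  map_id x := by rw [reassoc_of% F.map_id, G.map_id]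
  map_comp x y z := by rw [reassoc_of% F.map_comp, G.map_comp, tensorHom_comp_tensorHom_assoc]

lemma postcomp_map (F : EFunctor 𝒞 𝒟) {y z : O} (f : 𝟙_ B ⟶ 𝒞.hom y z) (x : O) :
    𝒞.postcomp f x ≫ F.map x z = F.map x y ≫ 𝒟.postcomp (f ≫ F.map y z) (F.obj x) := by
  simp only [ECat.postcomp, Category.assoc, F.map_comp, tensorHom_def']
  simp [← whisker_exchange_assoc]

lemma precomp_map (F : EFunctor 𝒞 𝒟) {x y : O} (f : 𝟙_ B ⟶ 𝒞.hom x y) (z : O) :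
    𝒞.precomp f z ≫ F.map x z = F.map y z ≫ 𝒟.precomp (f ≫ F.map x y) (F.obj z) := by
  simp only [ECat.precomp, Category.assoc, F.map_comp, MonoidalCategory.tensorHom_def]
  simp [whisker_exchange_assoc]

/-- The effect of an enriched functor on morphisms of the underlying category. -/
def umap (F : EFunctor 𝒞 𝒟) {x y : O} (f : 𝟙_ B ⟶ 𝒞.hom x y) :
    𝟙_ B ⟶ 𝒟.hom (F.obj x) (F.obj y) :=
  f ≫ F.map x y

/-- The functor induced on underlying categories. -/
def underlying (F : EFunctor 𝒞 𝒟) : 𝒞.Underlying ⥤ 𝒟.Underlying where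
  obj X := ⟨F.obj X.obj⟩
  map {X Y} f := F.umap f
  map_id X := F.map_id X.obj
  map_comp {X Y Z} f g := by
    change F.umap (𝒞.ucomp f g) = 𝒟.ucomp (F.umap f) (F.umap g)
    rw [ECat.ucomp_eq_postcomp, ECat.ucomp_eq_postcomp, umap, Category.assoc, postcomp_map]
    simp [umap]

end EFunctor

/-- Enriched natural isomorphisms: invertible morphisms `F x ⟶ G x` of the underlying category of
the target that make the square on hom objects commute. -/
structure ENatIso {O : Type w₁} {P : Type w₂} {𝒞 : ECat B O} {𝒟 : ECat B P}
    (F G : EFunctor 𝒞 𝒟) where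
  app (x : O) : (⟨F.obj x⟩ : 𝒟.Underlying) ≅ ⟨G.obj x⟩
  square (x y : O) : G.map x y ≫ 𝒟.precomp (app x).hom (G.obj y) =
    F.map x y ≫ 𝒟.postcomp (app y).hom (F.obj x)

/-- The square on hom objects implies naturality of the underlying family. -/
def ENatIso.underlying {O : Type w₁} {P : Type w₂} {𝒞 : ECat B O} {𝒟 : ECat B P}
    {F G : EFunctor 𝒞 𝒟} (ξ : ENatIso F G) : F.underlying ≅ G.underlying :=
  NatIso.ofComponents (fun X => ξ.app X.obj) (fun {X Y} f => by
    change 𝒟.ucomp (F.umap f) (ξ.app Y.obj).hom = 𝒟.ucomp (ξ.app X.obj).hom (G.umap f)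
    rw [ECat.ucomp_eq_postcomp, ECat.ucomp_eq_precomp]
    simp only [EFunctor.umap, Category.assoc, ξ.square])

end Basic

section Braided

variable {B : Type u₁} [Category.{v₁} B] [MonoidalCategory B] [BraidedCategory B]

/-- The exchange of the two middle factors by the inverse braiding. -/
def interchange (a b c d : B) : (a ⊗ b) ⊗ (c ⊗ d) ⟶ (a ⊗ c) ⊗ (b ⊗ d) :=
  (α_ a b (c ⊗ d)).hom ≫ a ◁ (α_ b c d).inv ≫ a ◁ (β_ c b).inv ▷ d ≫
    a ◁ (α_ c b d).hom ≫ (α_ a c (b ⊗ d)).inv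

lemma interchange_eq (a b c d : B) :
    interchange a b c d = @tensorμ B _ _ (reverseBraiding B) a b c d := rfl

lemma interchange_natural {a b c d a' b' c' d' : B} (f : a ⟶ a') (g : b ⟶ b') (h : c ⟶ c')
    (k : d ⟶ d') : ((f ⊗ₘ g) ⊗ₘ (h ⊗ₘ k)) ≫ interchange a' b' c' d' =
      interchange a b c d ≫ ((f ⊗ₘ h) ⊗ₘ (g ⊗ₘ k)) :=
  @tensorμ_natural B _ _ (reverseBraiding B) _ _ _ _ _ _ _ _ f g h k

lemma interchange_assoc' (a b c d e f : B) :
    (interchange a b c d ▷ (e ⊗ f)) ≫ interchange (a ⊗ c) (b ⊗ d) e f ≫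
        ((α_ a c e).hom ⊗ₘ (α_ b d f).hom) =
      (α_ (a ⊗ b) (c ⊗ d) (e ⊗ f)).hom ≫ ((a ⊗ b) ◁ interchange c d e f) ≫
        interchange a b (c ⊗ e) (d ⊗ f) :=
  @tensor_associativity B _ _ (reverseBraiding B) a b c d e f

lemma interchange_left_unit (a b : B) :
    ((λ_ (𝟙_ B)).inv ▷ (a ⊗ b)) ≫ interchange (𝟙_ B) (𝟙_ B) a b =
      (λ_ (a ⊗ b)).hom ≫ ((λ_ a).inv ⊗ₘ (λ_ b).inv) := by
  rw [@tensor_left_unitality B _ _ (reverseBraiding B) a b]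
  simp [interchange_eq]

lemma interchange_right_unit (a b : B) :
    ((a ⊗ b) ◁ (λ_ (𝟙_ B)).inv) ≫ interchange a b (𝟙_ B) (𝟙_ B) =
      (ρ_ (a ⊗ b)).hom ≫ ((ρ_ a).inv ⊗ₘ (ρ_ b).inv) := by
  rw [@tensor_right_unitality B _ _ (reverseBraiding B) a b]
  simp [interchange_eq]

lemma interchange_leftUnitor (a b : B) :
    ((λ_ a).inv ⊗ₘ (λ_ b).inv) ≫ interchange (𝟙_ B) a (𝟙_ B) b =
      (λ_ (a ⊗ b)).inv ≫ ((λ_ (𝟙_ B)).inv ▷ (a ⊗ b)) := by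
  have h := @leftUnitor_monoidal B _ _ (reverseBraiding B) a b
  rw [← interchange_eq] at h
  rw [← cancel_mono (((λ_ (𝟙_ B)).hom ▷ (a ⊗ b)) ≫ (λ_ (a ⊗ b)).hom), Category.assoc, ← h]
  simp

lemma interchange_rightUnitor (a b : B) :
    ((ρ_ a).inv ⊗ₘ (ρ_ b).inv) ≫ interchange a (𝟙_ B) b (𝟙_ B) =
      (ρ_ (a ⊗ b)).inv ≫ ((a ⊗ b) ◁ (λ_ (𝟙_ B)).inv) := by
  have h := @rightUnitor_monoidal B _ _ (reverseBraiding B) a b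
  rw [← interchange_eq] at h
  rw [← cancel_mono (((a ⊗ b) ◁ (λ_ (𝟙_ B)).hom) ≫ (ρ_ (a ⊗ b)).hom), Category.assoc, ← h]
  simp

lemma interchange_associator (a b c a' b' c' : B) :
    interchange (a ⊗ b) c (a' ⊗ b') c' ≫ (interchange a b a' b' ▷ (c ⊗ c')) ≫
        (α_ (a ⊗ a') (b ⊗ b') (c ⊗ c')).hom =
      ((α_ a b c).hom ⊗ₘ (α_ a' b' c').hom) ≫ interchange a (b ⊗ c) a' (b' ⊗ c') ≫
        ((a ⊗ a') ◁ interchange b c b' c') :=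
  @associator_monoidal B _ _ (reverseBraiding B) a b c a' b' c'

variable {O : Type w₁} {P : Type w₂} {Q : Type w₃} {R : Type w₄}

/-- The Cartesian product of enriched categories. -/
def ECat.prod (𝒞 : ECat B O) (𝒟 : ECat B P) : ECat B (O × P) where
  hom x y := 𝒞.hom x.1 y.1 ⊗ 𝒟.hom x.2 y.2
  id x := (λ_ (𝟙_ B)).inv ≫ (𝒞.id x.1 ⊗ₘ 𝒟.id x.2)
  comp x y z := interchange _ _ _ _ ≫ (𝒞.comp x.1 y.1 z.1 ⊗ₘ 𝒟.comp x.2 y.2 z.2)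
  comp_id x y := by
    have h := interchange_natural (𝟙 (𝒞.hom x.1 y.1)) (𝟙 (𝒟.hom x.2 y.2)) (𝒞.id x.1) (𝒟.id x.2)
    rw [tensorHom_id, id_whiskerRight, id_tensorHom, id_tensorHom, id_tensorHom] at h
    rw [MonoidalCategory.whiskerLeft_comp, Category.assoc, reassoc_of% h,
      reassoc_of% @interchange_right_unit]
    simp
  id_comp x y := by
    have h := interchange_natural (𝒞.id y.1) (𝒟.id y.2) (𝟙 (𝒞.hom x.1 y.1)) (𝟙 (𝒟.hom x.2 y.2))
    rw [id_tensorHom (𝒞.hom x.1 y.1), MonoidalCategory.whiskerLeft_id, tensorHom_id, tensorHom_id,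
      tensorHom_id] at h
    rw [comp_whiskerRight, Category.assoc, reassoc_of% h, reassoc_of% @interchange_left_unit]
    simp
  assoc x y z w := by
    have h1 := interchange_natural (𝟙 (𝒞.hom z.1 w.1)) (𝟙 (𝒟.hom z.2 w.2))
      (𝒞.comp x.1 y.1 z.1) (𝒟.comp x.2 y.2 z.2)
    rw [tensorHom_id, id_whiskerRight, id_tensorHom, id_tensorHom, id_tensorHom] at h1
    have h2 := interchange_natural (𝒞.comp y.1 z.1 w.1) (𝒟.comp y.2 z.2 w.2)
      (𝟙 (𝒞.hom x.1 y.1)) (𝟙 (𝒟.hom x.2 y.2))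
    rw [id_tensorHom (𝒞.hom x.1 y.1), MonoidalCategory.whiskerLeft_id, tensorHom_id, tensorHom_id,
      tensorHom_id] at h2
    rw [MonoidalCategory.whiskerLeft_comp, Category.assoc, reassoc_of% h1, comp_whiskerRight,
      Category.assoc, reassoc_of% h2, tensorHom_comp_tensorHom, tensorHom_comp_tensorHom,
      𝒞.assoc, 𝒟.assoc, Iso.eq_inv_comp, ← reassoc_of% (@interchange_assoc'), tensorHom_comp_tensorHom]
    simp

namespace EFunctor

variable {𝒞 : ECat B O} {𝒟 : ECat B P} {ℰ : ECat B Q} {𝒢 : ECat B R}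

/-- The product of two enriched functors. -/
def prodMap (F : EFunctor 𝒞 ℰ) (G : EFunctor 𝒟 𝒢) : EFunctor (𝒞.prod 𝒟) (ℰ.prod 𝒢) where
  obj x := (F.obj x.1, G.obj x.2)
  map x y := F.map x.1 y.1 ⊗ₘ G.map x.2 y.2
  map_id x := by simp [ECat.prod, F.map_id, G.map_id]
  map_comp x y z := by
    simp only [ECat.prod, Category.assoc, tensorHom_comp_tensorHom, F.map_comp, G.map_comp,
      reassoc_of% @interchange_natural]

/-- The canonical functor `(𝒞 × 𝒟) × ℰ → 𝒞 × (𝒟 × ℰ)`. -/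
def prodAssoc (𝒞 : ECat B O) (𝒟 : ECat B P) (ℰ : ECat B Q) :
    EFunctor ((𝒞.prod 𝒟).prod ℰ) (𝒞.prod (𝒟.prod ℰ)) where
  obj x := (x.1.1, x.1.2, x.2)
  map _ _ := (α_ _ _ _).hom
  map_id x := by
    simp only [ECat.prod, Category.assoc]
    have h : ∀ {a b c d e : B} (f : a ⟶ b) (g : c ⟶ d) (k : d ⟶ e),
        (f ⊗ₘ (g ≫ k)) = (a ◁ g) ≫ (f ⊗ₘ k) := by intros; simp [← id_tensorHom]
    have h' : ∀ {a b c d e : B} (f : a ⟶ b) (g : c ⟶ d) (k : d ⟶ e),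
        ((g ≫ k) ⊗ₘ f) = (g ▷ a) ≫ (k ⊗ₘ f) := by intros; simp [← tensorHom_id]
    rw [h, h', Category.assoc, associator_naturality]
    simp [unitors_inv_equal]
  map_comp x y z := by
    simp only [ECat.prod, Category.assoc]
    have h : ∀ {a b c d e : B} (f : a ⟶ b) (g : c ⟶ d) (k : d ⟶ e),
        (f ⊗ₘ (g ≫ k)) = (a ◁ g) ≫ (f ⊗ₘ k) := by intros; simp [← id_tensorHom]
    have h' : ∀ {a b c d e : B} (f : a ⟶ b) (g : c ⟶ d) (k : d ⟶ e),
        ((g ≫ k) ⊗ₘ f) = (g ▷ a) ≫ (k ⊗ₘ f) := by intros; simp [← tensorHom_id]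
    rw [h, h', Category.assoc, associator_naturality, reassoc_of% @interchange_associator]

/-- A bifunctor on hom objects, with the hom objects of the product written as tensor products. -/
def bimap (F : EFunctor (𝒞.prod 𝒟) ℰ) (x x' : O) (y y' : P) :
    𝒞.hom x x' ⊗ 𝒟.hom y y' ⟶ ℰ.hom (F.obj (x, y)) (F.obj (x', y')) :=
  F.map (x, y) (x', y')

lemma bimap_id (F : EFunctor (𝒞.prod 𝒟) ℰ) (x : O) (y : P) :
    (λ_ (𝟙_ B)).inv ≫ (𝒞.id x ⊗ₘ 𝒟.id y) ≫ F.bimap x x y y = ℰ.id (F.obj (x, y)) := by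
  rw [← F.map_id (x, y)]
  exact (Category.assoc _ _ _).symm

lemma bimap_comp (F : EFunctor (𝒞.prod 𝒟) ℰ) (x x' x'' : O) (y y' y'' : P) :
    (F.bimap x' x'' y' y'' ⊗ₘ F.bimap x x' y y') ≫ ℰ.comp _ _ _ =
      interchange _ _ _ _ ≫ (𝒞.comp x x' x'' ⊗ₘ 𝒟.comp y y' y'') ≫ F.bimap x x'' y y'' :=
  (F.map_comp (x, y) (x', y') (x'', y'')).symm.trans (Category.assoc _ _ _)

/-- The enriched functor `F(x, -)`. -/
def fixLeft (F : EFunctor (𝒞.prod 𝒟) ℰ) (x : O) : EFunctor 𝒟 ℰ where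
  obj y := F.obj (x, y)
  map y z := (λ_ _).inv ≫ 𝒞.id x ▷ 𝒟.hom y z ≫ F.bimap x x y z
  map_id y := by
    rw [← F.bimap_id]
    simp [tensorHom_def']
  map_comp y z w := by
    have e : (λ_ (𝟙_ B)).inv ≫ (𝒞.id x ⊗ₘ 𝒞.id x) ≫ 𝒞.comp x x x = 𝒞.id x := by
      change 𝒞.ucomp _ _ = _
      rw [ECat.ucomp_eq_postcomp, ECat.postcomp_id, Category.comp_id]
    simp only [← tensorHom_comp_tensorHom, Category.assoc, F.bimap_comp]
    simp only [← tensorHom_id, reassoc_of% @interchange_natural,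
      reassoc_of% @interchange_leftUnitor, tensorHom_comp_tensorHom_assoc, e]
    simp [tensorHom_def']

/-- The enriched functor `F(-, y)`. -/
def fixRight (F : EFunctor (𝒞.prod 𝒟) ℰ) (y : P) : EFunctor 𝒞 ℰ where
  obj x := F.obj (x, y)
  map x z := (ρ_ _).inv ≫ 𝒞.hom x z ◁ 𝒟.id y ≫ F.bimap x z y y
  map_id x := by
    rw [← F.bimap_id]
    simp [MonoidalCategory.tensorHom_def, unitors_inv_equal]
  map_comp x z w := by
    have e : (λ_ (𝟙_ B)).inv ≫ (𝒟.id y ⊗ₘ 𝒟.id y) ≫ 𝒟.comp y y y = 𝒟.id y := by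
      change 𝒟.ucomp _ _ = _
      rw [ECat.ucomp_eq_postcomp, ECat.postcomp_id, Category.comp_id]
    simp only [← tensorHom_comp_tensorHom, Category.assoc, F.bimap_comp]
    simp only [← id_tensorHom, reassoc_of% @interchange_natural,
      reassoc_of% @interchange_rightUnitor, tensorHom_comp_tensorHom_assoc, e]
    simp [MonoidalCategory.tensorHom_def]

/-- The effect of a bifunctor on a pair of morphisms of the underlying categories. -/
def map₂ (F : EFunctor (𝒞.prod 𝒟) ℰ) {x x' : O} {y y' : P} (f : 𝟙_ B ⟶ 𝒞.hom x x')
    (g : 𝟙_ B ⟶ 𝒟.hom y y') : 𝟙_ B ⟶ ℰ.hom (F.obj (x, y)) (F.obj (x', y')) :=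
  (λ_ (𝟙_ B)).inv ≫ (f ⊗ₘ g) ≫ F.bimap x x' y y'

lemma map₂_eq_fixLeft (F : EFunctor (𝒞.prod 𝒟) ℰ) (x : O) {y y' : P}
    (g : 𝟙_ B ⟶ 𝒟.hom y y') : F.map₂ (𝒞.id x) g = (F.fixLeft x).umap g := by
  simp [map₂, fixLeft, umap, tensorHom_def']

lemma map₂_eq_fixRight (F : EFunctor (𝒞.prod 𝒟) ℰ) {x x' : O} (y : P)
    (f : 𝟙_ B ⟶ 𝒞.hom x x') : F.map₂ f (𝒟.id y) = (F.fixRight y).umap f := by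
  simp [map₂, fixRight, umap, MonoidalCategory.tensorHom_def, unitors_inv_equal]

lemma map₂_id (F : EFunctor (𝒞.prod 𝒟) ℰ) (x : O) (y : P) :
    F.map₂ (𝒞.id x) (𝒟.id y) = ℰ.id (F.obj (x, y)) :=
  F.bimap_id x y

lemma map₂_ucomp (F : EFunctor (𝒞.prod 𝒟) ℰ) {x x' x'' : O} {y y' y'' : P}
    (f : 𝟙_ B ⟶ 𝒞.hom x x') (f' : 𝟙_ B ⟶ 𝒞.hom x' x'')
    (g : 𝟙_ B ⟶ 𝒟.hom y y') (g' : 𝟙_ B ⟶ 𝒟.hom y' y'') :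
    F.map₂ (𝒞.ucomp f f') (𝒟.ucomp g g') = ℰ.ucomp (F.map₂ f g) (F.map₂ f' g') := by
  have e : ((λ_ (𝟙_ B)).inv ⊗ₘ (λ_ (𝟙_ B)).inv) ≫ interchange (𝟙_ B) (𝟙_ B) (𝟙_ B) (𝟙_ B) =
      ((λ_ (𝟙_ B)).inv ⊗ₘ (λ_ (𝟙_ B)).inv) := by
    rw [interchange_leftUnitor, tensorHom_def']
    simp
  simp only [map₂, ECat.ucomp, ← tensorHom_comp_tensorHom, Category.assoc, F.bimap_comp,
    reassoc_of% @interchange_natural, reassoc_of% e]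

end EFunctor

end Braided

section Intersections

variable {B : Type u₁} [Category.{v₁} B]

/-- The intersection of an arbitrary family of subobjects of any object exists: it is a subobject
through which a morphism factors exactly if it factors through all members of the family. -/
class HasIntersections (B : Type u₁) [Category.{v₁} B] : Prop where
  exists_inter (X : B) (S : Set (Subobject X)) : ∃ t : Subobject X,
    ∀ {W : B} (f : W ⟶ X), t.Factors f ↔ ∀ s ∈ S, s.Factors f

/-- The intersection of a family of subobjects. -/
def inter [HasIntersections B] {X : B} (S : Set (Subobject X)) : Subobject X :=
  (HasIntersections.exists_inter X S).choose

lemma inter_factors [HasIntersections B] {X W : B} (S : Set (Subobject X)) (f : W ⟶ X) :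
    (inter S).Factors f ↔ ∀ s ∈ S, s.Factors f :=
  (HasIntersections.exists_inter X S).choose_spec f

end Intersections

section Monoidal

variable {B : Type u₁} [Category.{v₁} B] [MonoidalCategory B] [BraidedCategory B]
variable {O : Type w₁}

/-- The data of a monoidal category enriched over `B`, without the pentagon and triangle axioms. -/
structure MonECatStruct (B : Type u₁) [Category.{v₁} B] [MonoidalCategory B] [BraidedCategory B]
    (O : Type w₁) extends ECat B O where
  unit : O
  tensor : EFunctor (toECat.prod toECat) toECat
  leftUnitor : ENatIso (tensor.fixLeft unit) (EFunctor.id toECat)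
  rightUnitor : ENatIso (tensor.fixRight unit) (EFunctor.id toECat)
  associator : ENatIso ((tensor.prodMap (EFunctor.id toECat)).comp tensor)
    ((EFunctor.prodAssoc toECat toECat toECat).comp
      (((EFunctor.id toECat).prodMap tensor).comp tensor))

namespace MonECatStruct

variable (M : MonECatStruct B O)

/-- The tensor product of objects. -/
abbrev tensorObj (x y : O) : O := M.tensor.obj (x, y)

/-- The operation `x ⊗ -` on hom objects. -/
def whiskL (x y z : O) : M.hom y z ⟶ M.hom (M.tensorObj x y) (M.tensorObj x z) :=
  (M.tensor.fixLeft x).map y z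

/-- The operation `- ⊗ x` on hom objects. -/
def whiskR (x y z : O) : M.hom y z ⟶ M.hom (M.tensorObj y x) (M.tensorObj z x) :=
  (M.tensor.fixRight x).map y z

/-- The components of the associator. -/
def assocHom (x y z : O) : 𝟙_ B ⟶ M.hom (M.tensor.obj (M.tensor.obj (x, y), z))
    (M.tensor.obj (x, M.tensor.obj (y, z))) :=
  (M.associator.app ((x, y), z)).hom

/-- The tensor product, associator and unitors on the underlying category. -/
instance : MonoidalCategoryStruct M.Underlying where
  tensorObj X Y := ⟨M.tensorObj X.obj Y.obj⟩
  tensorHom f g := M.tensor.map₂ f g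
  whiskerLeft X _ _ f := M.tensor.map₂ (M.id X.obj) f
  whiskerRight f Y := M.tensor.map₂ f (M.id Y.obj)
  tensorUnit := ⟨M.unit⟩
  associator X Y Z := M.associator.app ((X.obj, Y.obj), Z.obj)
  leftUnitor X := M.leftUnitor.app X.obj
  rightUnitor X := M.rightUnitor.app X.obj

/-- The pentagon axiom in the underlying category. -/
def Pentagon : Prop := ∀ W X Y Z : M.Underlying,
  ((α_ W X Y).hom ⊗ₘ 𝟙 Z) ≫ (α_ W (X ⊗ Y) Z).hom ≫ (𝟙 W ⊗ₘ (α_ X Y Z).hom) =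
    (α_ (W ⊗ X) Y Z).hom ≫ (α_ W X (Y ⊗ Z)).hom

/-- The triangle axiom in the underlying category. -/
def Triangle : Prop := ∀ X Y : M.Underlying,
  (α_ X (𝟙_ M.Underlying) Y).hom ≫ (𝟙 X ⊗ₘ (λ_ Y).hom) = (ρ_ X).hom ⊗ₘ 𝟙 Y

end MonECatStruct

/-- A monoidal category enriched over `B`: the pentagon and the triangle commute in the underlying
category. -/
structure MonECat (B : Type u₁) [Category.{v₁} B] [MonoidalCategory B] [BraidedCategory B]
    (O : Type w₁) extends MonECatStruct B O where
  pentagon : toMonECatStruct.Pentagon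
  triangle : toMonECatStruct.Triangle

namespace MonECat

variable (M : MonECat B O)

lemma associator_square (x y z x' y' z' : O) :
    (α_ (M.hom x x') (M.hom y y') (M.hom z z')).hom ≫
      M.hom x x' ◁ M.tensor.bimap y y' z z' ≫ M.tensor.bimap x x' _ _ ≫
        M.precomp (M.assocHom x y z) _ =
    M.tensor.bimap x x' y y' ▷ M.hom z z' ≫ M.tensor.bimap _ _ z z' ≫
      M.postcomp (M.assocHom x' y' z') _ := by
  have h : ((α_ (M.hom x x') (M.hom y y') (M.hom z z')).hom ≫
      (𝟙 (M.hom x x') ⊗ₘ M.tensor.bimap y y' z z') ≫ M.tensor.bimap x x' _ _) ≫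
        M.precomp (M.assocHom x y z) _ =
      ((M.tensor.bimap x x' y y' ⊗ₘ 𝟙 (M.hom z z')) ≫ M.tensor.bimap _ _ z z') ≫
        M.postcomp (M.assocHom x' y' z') _ :=
    M.associator.square ((x, y), z) ((x', y'), z')
  simpa using h

lemma associator_map₂ {x y z x' y' z' : O} (f : 𝟙_ B ⟶ M.hom x x') (g : 𝟙_ B ⟶ M.hom y y')
    (h : 𝟙_ B ⟶ M.hom z z') :
    M.ucomp (M.tensor.map₂ (M.tensor.map₂ f g) h) (M.assocHom x' y' z') =
      M.ucomp (M.assocHom x y z) (M.tensor.map₂ f (M.tensor.map₂ g h)) := by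
  rw [ECat.ucomp_eq_postcomp, ECat.ucomp_eq_precomp]
  have h1 : M.tensor.map₂ f g ⊗ₘ h = (λ_ (𝟙_ B)).inv ▷ 𝟙_ B ≫ ((f ⊗ₘ g) ⊗ₘ h) ≫
      M.tensor.bimap x x' y y' ▷ _ := by
    simp only [← tensorHom_id, EFunctor.map₂, tensorHom_comp_tensorHom, Category.id_comp,
      Category.comp_id]
  have h2 : f ⊗ₘ M.tensor.map₂ g h = 𝟙_ B ◁ (λ_ (𝟙_ B)).inv ≫ (f ⊗ₘ (g ⊗ₘ h)) ≫
      _ ◁ M.tensor.bimap y y' z z' := by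
    simp only [← id_tensorHom, EFunctor.map₂, tensorHom_comp_tensorHom, Category.id_comp,
      Category.comp_id]
  have h3 : (λ_ (𝟙_ B)).inv ≫ 𝟙_ B ◁ (λ_ (𝟙_ B)).inv =
      (λ_ (𝟙_ B)).inv ≫ (λ_ (𝟙_ B)).inv ▷ 𝟙_ B ≫ (α_ _ _ _).hom := by
    simp [unitors_inv_equal]
  conv_lhs => rw [EFunctor.map₂, h1]
  conv_rhs => rw [EFunctor.map₂, h2]
  simp only [Category.assoc, ← M.associator_square]
  rw [associator_naturality_assoc, reassoc_of% h3]

/-- The underlying monoidal category. -/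
instance : MonoidalCategory M.Underlying :=
  MonoidalCategory.ofTensorHom
    (id_tensorHom_id := fun X Y => M.tensor.map₂_id X.obj Y.obj)
    (id_tensorHom := fun _ _ _ _ => rfl)
    (tensorHom_id := fun _ _ => rfl)
    (tensorHom_comp_tensorHom := fun f₁ f₂ g₁ g₂ => (M.tensor.map₂_ucomp f₁ g₁ f₂ g₂).symm)
    (associator_naturality := fun f₁ f₂ f₃ => M.associator_map₂ f₁ f₂ f₃)
    (leftUnitor_naturality := fun {X Y} f => by
      have := M.leftUnitor.underlying.hom.naturality f
      change M.ucomp (M.tensor.map₂ (M.id M.unit) f) _ = _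
      rw [EFunctor.map₂_eq_fixLeft]
      refine this.trans ?_
      change M.ucomp _ (f ≫ 𝟙 _) = _
      rw [Category.comp_id]
      rfl)
    (rightUnitor_naturality := fun {X Y} f => by
      have := M.rightUnitor.underlying.hom.naturality f
      change M.ucomp (M.tensor.map₂ f (M.id M.unit)) _ = _
      rw [EFunctor.map₂_eq_fixRight]
      refine this.trans ?_
      change M.ucomp _ (f ≫ 𝟙 _) = _
      rw [Category.comp_id]
      rfl)
    (pentagon := M.pentagon)
    (triangle := M.triangle)

/-- A half-braiding for `x`: an enriched natural isomorphism `x ⊗ - ≅ - ⊗ x` that is compatible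
with the tensor product, as an isomorphism in the underlying monoidal category. -/
structure EHalfBraiding (x : O) where
  iso : ENatIso (M.tensor.fixLeft x) (M.tensor.fixRight x)
  monoidal (U V : M.Underlying) :
    let b (W : M.Underlying) : (⟨x⟩ : M.Underlying) ⊗ W ⟶ W ⊗ ⟨x⟩ := (iso.app W.obj).hom
    b (U ⊗ V) = (α_ _ _ _).inv ≫ b U ▷ V ≫ (α_ _ _ _).hom ≫ U ◁ b V ≫ (α_ _ _ _).inv

/-- The component `x ⊗ z ⟶ z ⊗ x` of a half-braiding. -/
def EHalfBraiding.hom {M : MonECat B O} {x : O} (b : M.EHalfBraiding x) (z : O) :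
    𝟙_ B ⟶ M.hom (M.tensorObj x z) (M.tensorObj z x) :=
  (b.iso.app z).hom

lemma EHalfBraiding.square {M : MonECat B O} {x : O} (b : M.EHalfBraiding x) (y z : O) :
    M.whiskR x y z ≫ M.precomp (b.hom y) _ = M.whiskL x y z ≫ M.postcomp (b.hom z) _ :=
  b.iso.square y z

/-- An enriched half-braiding is a half-braiding in the underlying monoidal category. -/
def EHalfBraiding.toHalfBraiding {M : MonECat B O} {x : O} (b : M.EHalfBraiding x) :
    HalfBraiding (⟨x⟩ : M.Underlying) where
  β U := b.iso.app U.obj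
  monoidal U V := b.monoidal U V
  naturality {U V} f := by
    have := b.iso.underlying.hom.naturality f
    change M.ucomp (M.tensor.map₂ (M.id x) f) _ = M.ucomp _ (M.tensor.map₂ f (M.id x))
    rw [EFunctor.map₂_eq_fixLeft, EFunctor.map₂_eq_fixRight]
    exact this

/-- The objects of the Drinfeld center. -/
structure ECenter where
  obj : O
  braiding : M.EHalfBraiding obj

end MonECat

namespace MonECat

variable {M : MonECat B O}

namespace ECenter

/-- The morphism `hom x y ⟶ hom (x ⊗ z) (z ⊗ y)` given by `z ⊗ -` followed by `- ∘ b_{x,z}`. -/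
def eqL (X Y : M.ECenter) (z : O) :
    M.hom X.obj Y.obj ⟶ M.hom (M.tensorObj X.obj z) (M.tensorObj z Y.obj) :=
  M.whiskL z X.obj Y.obj ≫ M.precomp (X.braiding.hom z) _

/-- The morphism `hom x y ⟶ hom (x ⊗ z) (z ⊗ y)` given by `- ⊗ z` followed by `b_{y,z} ∘ -`. -/
def eqR (X Y : M.ECenter) (z : O) :
    M.hom X.obj Y.obj ⟶ M.hom (M.tensorObj X.obj z) (M.tensorObj z Y.obj) :=
  M.whiskR z X.obj Y.obj ≫ M.postcomp (Y.braiding.hom z) _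

lemma comp_eqL (X Y : M.ECenter) (z : O) (f : 𝟙_ B ⟶ M.hom X.obj Y.obj) :
    f ≫ eqL X Y z = M.ucomp (X.braiding.hom z) (M.tensor.map₂ (M.id z) f) := by
  rw [ECat.ucomp_eq_precomp, EFunctor.map₂_eq_fixLeft]
  exact (Category.assoc f _ _).symm

lemma comp_eqR (X Y : M.ECenter) (z : O) (f : 𝟙_ B ⟶ M.hom X.obj Y.obj) :
    f ≫ eqR X Y z = M.ucomp (M.tensor.map₂ f (M.id z)) (Y.braiding.hom z) := by
  rw [ECat.ucomp_eq_postcomp, EFunctor.map₂_eq_fixRight]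
  exact (Category.assoc f _ _).symm

variable [HasEqualizers B] [HasIntersections B]

/-- The hom object of the Drinfeld center, as a subobject of the hom object of `M`: the
intersection over all `z` of the equalizers of the two morphisms above. -/
def homSub (X Y : M.ECenter) : Subobject (M.hom X.obj Y.obj) :=
  inter (Set.range fun z : O => equalizerSubobject (eqL X Y z) (eqR X Y z))

lemma homSub_factors (X Y : M.ECenter) {W : B} (f : W ⟶ M.hom X.obj Y.obj) :
    (homSub X Y).Factors f ↔ ∀ z, f ≫ eqL X Y z = f ≫ eqR X Y z := by
  simp only [homSub, inter_factors, Set.forall_mem_range, equalizerSubobject_factors_iff]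

/-- The inclusion of the hom object of the Drinfeld center. -/
def ι (X Y : M.ECenter) : (homSub X Y : B) ⟶ M.hom X.obj Y.obj := (homSub X Y).arrow

instance (X Y : M.ECenter) : Mono (ι X Y) := inferInstanceAs (Mono (homSub X Y).arrow)

lemma ι_eq (X Y : M.ECenter) (z : O) : ι X Y ≫ eqL X Y z = ι X Y ≫ eqR X Y z :=
  (homSub_factors X Y _).1 (Subobject.factors_self _) z

lemma id_factors (X : M.ECenter) : (homSub X X).Factors (M.id X.obj) := by
  rw [homSub_factors]
  intro z
  have h1 : M.id X.obj ≫ M.whiskL z X.obj X.obj = M.id _ := (M.tensor.fixLeft z).map_id X.obj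
  have h2 : M.id X.obj ≫ M.whiskR z X.obj X.obj = M.id _ := (M.tensor.fixRight z).map_id X.obj
  rw [eqL, eqR, reassoc_of% h1, reassoc_of% h2, ← ECat.ucomp_eq_postcomp,
    ← ECat.ucomp_eq_precomp]
  rw [ECat.ucomp_eq_postcomp, ECat.ucomp_eq_precomp]
  simp

lemma comp_factors (X Y Z : M.ECenter) :
    (homSub X Z).Factors ((ι Y Z ⊗ₘ ι X Y) ≫ M.comp X.obj Y.obj Z.obj) := by
  rw [homSub_factors]
  intro z
  have h1 : M.comp X.obj Y.obj Z.obj ≫ M.whiskL z X.obj Z.obj =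
      (M.whiskL z Y.obj Z.obj ⊗ₘ M.whiskL z X.obj Y.obj) ≫ M.comp _ _ _ :=
    (M.tensor.fixLeft z).map_comp _ _ _
  have h2 : M.comp X.obj Y.obj Z.obj ≫ M.whiskR z X.obj Z.obj =
      (M.whiskR z Y.obj Z.obj ⊗ₘ M.whiskR z X.obj Y.obj) ≫ M.comp _ _ _ :=
    (M.tensor.fixRight z).map_comp _ _ _
  have e1 := ι_eq X Y z
  have e2 := ι_eq Y Z z
  rw [eqL, eqR] at e1 e2
  simp only [eqL, eqR, Category.assoc, reassoc_of% h1, reassoc_of% h2, ECat.comp_postcomp,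
    ECat.comp_precomp]
  calc _ = ((ι Y Z ≫ M.whiskL z Y.obj Z.obj) ⊗ₘ
        (ι X Y ≫ M.whiskL z X.obj Y.obj ≫ M.precomp (X.braiding.hom z) _)) ≫ M.comp _ _ _ := by
        simp [MonoidalCategory.tensorHom_def, whisker_exchange_assoc]
    _ = ((ι Y Z ≫ M.whiskL z Y.obj Z.obj) ⊗ₘ (ι X Y ≫ M.whiskR z X.obj Y.obj)) ≫
          _ ◁ M.postcomp (Y.braiding.hom z) _ ≫ M.comp _ _ _ := by
        rw [e1]; simp [MonoidalCategory.tensorHom_def]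
    _ = ((ι Y Z ≫ M.whiskL z Y.obj Z.obj ≫ M.precomp (Y.braiding.hom z) _) ⊗ₘ
          (ι X Y ≫ M.whiskR z X.obj Y.obj)) ≫ M.comp _ _ _ := by
        rw [← ECat.precomp_comp]; simp [tensorHom_def']
    _ = _ := by
        rw [e2]; simp [tensorHom_def', ← whisker_exchange_assoc]

/-- Composition in the Drinfeld center. -/
def comp (X Y Z : M.ECenter) : (homSub Y Z : B) ⊗ (homSub X Y : B) ⟶ (homSub X Z : B) :=
  (homSub X Z).factorThru _ (comp_factors X Y Z)

lemma comp_ι (X Y Z : M.ECenter) :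
    comp X Y Z ≫ ι X Z = (ι Y Z ⊗ₘ ι X Y) ≫ M.comp X.obj Y.obj Z.obj :=
  Subobject.factorThru_arrow _ _ _

/-- Identities in the Drinfeld center. -/
def id (X : M.ECenter) : 𝟙_ B ⟶ (homSub X X : B) :=
  (homSub X X).factorThru _ (id_factors X)

lemma id_ι (X : M.ECenter) : id X ≫ ι X X = M.id X.obj :=
  Subobject.factorThru_arrow _ _ _

end ECenter

variable [HasEqualizers B] [HasIntersections B]

/-- The Drinfeld center of `M`, as a category enriched over `B`. -/
def center (M : MonECat B O) : ECat B M.ECenter where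
  hom X Y := (ECenter.homSub X Y : B)
  id := ECenter.id
  comp := ECenter.comp
  comp_id X Y := by
    rw [← cancel_mono (ECenter.ι X Y)]
    simp only [Category.assoc, ECenter.comp_ι, Category.id_comp]
    rw [← id_tensorHom, tensorHom_comp_tensorHom_assoc, ECenter.id_ι, Category.id_comp,
      MonoidalCategory.tensorHom_def, Category.assoc, ← rightUnitor_inv_naturality_assoc]
    simp
  id_comp X Y := by
    rw [← cancel_mono (ECenter.ι X Y)]
    simp only [Category.assoc, ECenter.comp_ι, Category.id_comp]
    rw [← tensorHom_id, tensorHom_comp_tensorHom_assoc, ECenter.id_ι, Category.id_comp,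
      tensorHom_def', Category.assoc, ← leftUnitor_inv_naturality_assoc]
    simp
  assoc X Y Z W := by
    rw [← cancel_mono (ECenter.ι X W)]
    simp only [Category.assoc, ECenter.comp_ι]
    rw [← id_tensorHom, ← tensorHom_id, tensorHom_comp_tensorHom_assoc,
      tensorHom_comp_tensorHom_assoc, ECenter.comp_ι, ECenter.comp_ι, Category.id_comp,
      Category.id_comp]
    have h1 : ∀ {a b c d e : B} (f : a ⟶ b) (g : c ⟶ d) (k : d ⟶ e),
        (f ⊗ₘ (g ≫ k)) = (f ⊗ₘ g) ≫ b ◁ k := by intros; simp [← id_tensorHom]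
    have h2 : ∀ {a b c d e : B} (f : a ⟶ b) (g : c ⟶ d) (k : d ⟶ e),
        ((g ≫ k) ⊗ₘ f) = (g ⊗ₘ f) ≫ k ▷ b := by intros; simp [← tensorHom_id]
    rw [h1, h2, Category.assoc, Category.assoc, ECat.assoc, associator_inv_naturality_assoc]

/-- The forgetful functor from the Drinfeld center, given by the inclusions of hom objects. -/
def centerForget (M : MonECat B O) : EFunctor M.center M.toECat where
  obj X := X.obj
  map X Y := ECenter.ι X Y
  map_id X := ECenter.id_ι X
  map_comp X Y Z := ECenter.comp_ι X Y Z

lemma centerForget_eq (M : MonECat B O) (X Y : M.ECenter) {w : B} (f : w ⟶ M.center.hom X Y)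
    (z : O) : (f ≫ M.centerForget.map X Y) ≫ ECenter.eqL X Y z =
      (f ≫ M.centerForget.map X Y) ≫ ECenter.eqR X Y z :=
  (Category.assoc f _ _).trans ((congrArg (fun t => f ≫ t) (ECenter.ι_eq X Y z)).trans
    (Category.assoc f _ _).symm)

end MonECat

end Monoidal

section Coherence

open Functor.OplaxMonoidal

variable {B : Type u₁} [Category.{v₁} B] [MonoidalCategory B]
variable {C : Type u₂} [Category.{v₂} C] [MonoidalCategory C]

/-- Exchange of the middle factors along a morphism `t`. -/
def middle {b c b' c' : C} (a : C) (t : b ⊗ c ⟶ c' ⊗ b') (d : C) :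
    (a ⊗ b) ⊗ (c ⊗ d) ⟶ (a ⊗ c') ⊗ (b' ⊗ d) :=
  (α_ _ _ _).hom ≫ a ◁ (α_ _ _ _).inv ≫ a ◁ t ▷ d ≫ a ◁ (α_ _ _ _).hom ≫ (α_ _ _ _).inv

lemma middle_natural {a a' b b' x : C} (f : a ⟶ a') (g : b ⟶ b') (t : b ⊗ x ⟶ x ⊗ b)
    (t' : b' ⊗ x ⟶ x ⊗ b') (h : g ▷ x ≫ t' = t ≫ x ◁ g) (y : C) :
    (f ⊗ₘ g) ▷ (x ⊗ y) ≫ middle a' t' y = middle a t y ≫ (f ▷ x ⊗ₘ g ▷ y) := by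
  simp only [middle]
  rw [MonoidalCategory.tensorHom_def]
  calc
    _ = 𝟙 _ ⊗≫ f ▷ (b ⊗ x ⊗ y) ⊗≫ a' ◁ (g ▷ x ≫ t') ▷ y ⊗≫ 𝟙 _ := by
      monoidal
    _ = 𝟙 _ ⊗≫ (f ▷ (b ⊗ x ⊗ y) ≫ a' ◁
        ((α_ _ _ _).inv ≫ (t ≫ x ◁ g) ▷ y ≫ (α_ _ _ _).hom)) ⊗≫ 𝟙 _ := by
      rw [h]; monoidal
    _ = _ := by
      rw [← whisker_exchange, MonoidalCategory.tensorHom_def']; monoidal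

lemma δ_split (F : B ⥤ C) [F.OplaxMonoidal] (p q r s : B) :
    δ F (p ⊗ q) (r ⊗ s) ≫ (δ F p q ⊗ₘ δ F r s) ≫ (α_ _ _ _).hom ≫ F.obj p ◁ (α_ _ _ _).inv =
      F.map ((α_ p q (r ⊗ s)).hom ≫ p ◁ (α_ q r s).inv) ≫ δ F p ((q ⊗ r) ⊗ s) ≫
        F.obj p ◁ (δ F (q ⊗ r) s ≫ δ F q r ▷ F.obj s) := by
  have h1 := oplax_associativity F p q (r ⊗ s)
  have h2 := oplax_associativity F q r s
  have h3 : F.map (α_ q r s).inv ≫ δ F (q ⊗ r) s ≫ δ F q r ▷ F.obj s =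
      δ F q (r ⊗ s) ≫ F.obj q ◁ δ F r s ≫ (α_ _ _ _).inv := by
    rw [← cancel_mono (α_ _ _ _).hom, ← cancel_epi (F.map (α_ q r s).hom)]
    simp only [Category.assoc, Iso.inv_hom_id, Category.comp_id, ← h2]
    rw [← F.map_comp_assoc, Iso.hom_inv_id, F.map_id, Category.id_comp]
  calc _ = (δ F (p ⊗ q) (r ⊗ s) ≫ δ F p q ▷ F.obj (r ⊗ s) ≫ (α_ _ _ _).hom) ≫
        F.obj p ◁ (F.obj q ◁ δ F r s ≫ (α_ _ _ _).inv) := by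
        simp [MonoidalCategory.tensorHom_def]
    _ = F.map (α_ p q (r ⊗ s)).hom ≫ δ F p (q ⊗ (r ⊗ s)) ≫
          F.obj p ◁ (F.map (α_ q r s).inv ≫ δ F (q ⊗ r) s ≫ δ F q r ▷ F.obj s) := by
        rw [h1, h3]; simp only [MonoidalCategory.whiskerLeft_comp, Category.assoc]
    _ = _ := by
        simp only [MonoidalCategory.whiskerLeft_comp, Functor.map_comp, Category.assoc]
        rw [δ_natural_right_assoc]

lemma δ_middle (F : B ⥤ C) [F.OplaxMonoidal] (p : B) {q r q' r' : B} (s : B)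
    (k : q ⊗ r ⟶ r' ⊗ q') (t : F.obj q ⊗ F.obj r ⟶ F.obj r' ⊗ F.obj q')
    (h : δ F q r ≫ t = F.map k ≫ δ F r' q') :
    F.map (middle p k s) ≫ δ F _ _ ≫ (δ F p r' ⊗ₘ δ F q' s) =
      δ F _ _ ≫ (δ F p q ⊗ₘ δ F r s) ≫ middle (F.obj p) t (F.obj s) := by
  have h1 := δ_split F p q r s
  have h2 := δ_split F p r' q' s
  rw [← cancel_mono ((α_ _ _ _).hom ≫ F.obj p ◁ (α_ _ _ _).inv)]
  simp only [Category.assoc, h2]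
  rw [middle, middle]
  simp only [Category.assoc, reassoc_of% h1]
  simp only [← F.map_comp_assoc, Category.assoc]
  simp only [Iso.inv_hom_id_assoc, ← MonoidalCategory.whiskerLeft_comp, Iso.hom_inv_id,
    ← comp_whiskerRight, h, Category.comp_id, Category.assoc]
  simp only [Functor.map_comp, MonoidalCategory.whiskerLeft_comp, comp_whiskerRight,
    Category.assoc]
  simp only [← δ_natural_right_assoc, ← MonoidalCategory.whiskerLeft_comp_assoc, δ_natural_left]

lemma middle_comp {a b c e x y x' x'' y' y'' : C} (hb : HalfBraiding b) (he : HalfBraiding e)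
    (v₁ : c ⊗ x ⟶ x') (v₂ : e ⊗ y ⟶ y') (w₁ : a ⊗ x' ⟶ x'') (w₂ : b ⊗ y' ⟶ y'') :
    middle a (hb.β c).hom e ▷ (x ⊗ y) ≫
      middle (a ⊗ c) ((α_ _ _ _).hom ≫ b ◁ (he.β x).hom ≫ (α_ _ _ _).inv ≫ (hb.β x).hom ▷ e ≫
        (α_ _ _ _).hom) y ≫
      (((α_ _ _ _).hom ≫ a ◁ v₁ ≫ w₁) ⊗ₘ ((α_ _ _ _).hom ≫ b ◁ v₂ ≫ w₂)) =
    (α_ _ _ _).hom ≫ (a ⊗ b) ◁ (middle c (he.β x).hom y ≫ (v₁ ⊗ₘ v₂)) ≫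
      middle a (hb.β x').hom y' ≫ (w₁ ⊗ₘ w₂) := by
  have hn : (b ◁ v₁) ≫ (hb.β x').hom = (hb.β (c ⊗ x)).hom ≫ v₁ ▷ b := hb.naturality v₁
  have hm := hb.monoidal c x
  have hw : ((α_ a c x).hom ≫ a ◁ v₁ ≫ w₁) ⊗ₘ ((α_ b e y).hom ≫ b ◁ v₂ ≫ w₂) =
      ((α_ a c x).hom ⊗ₘ (α_ b e y).hom) ≫ (a ◁ v₁) ▷ (b ⊗ (e ⊗ y)) ≫
        (a ⊗ x') ◁ (b ◁ v₂) ≫ (w₁ ⊗ₘ w₂) := by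
    simp only [← tensorHom_id, ← id_tensorHom, tensorHom_comp_tensorHom, Category.id_comp]
  rw [hw]
  simp only [← Category.assoc]
  congr 1
  simp only [middle, Category.assoc]
  calc
    _ = 𝟙 _ ⊗≫ a ◁ ((hb.β c).hom ▷ (e ⊗ x) ≫ (c ⊗ b) ◁ (he.β x).hom) ▷ y ⊗≫
          a ◁ c ◁ (hb.β x).hom ▷ e ▷ y ⊗≫ a ◁ v₁ ▷ b ▷ (e ⊗ y) ⊗≫ a ◁ x' ◁ b ◁ v₂ ⊗≫ 𝟙 _ := by
        monoidal
    _ = 𝟙 _ ⊗≫ a ◁ b ◁ c ◁ (he.β x).hom ▷ y ⊗≫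
          a ◁ ((α_ b c x).inv ≫ (hb.β c).hom ▷ x ≫ (α_ c b x).hom ≫ c ◁ (hb.β x).hom ≫
            (α_ c x b).inv) ▷ (e ⊗ y) ⊗≫
          a ◁ v₁ ▷ b ▷ (e ⊗ y) ⊗≫ a ◁ x' ◁ b ◁ v₂ ⊗≫ 𝟙 _ := by
        rw [← whisker_exchange]; monoidal
    _ = 𝟙 _ ⊗≫ a ◁ b ◁ c ◁ (he.β x).hom ▷ y ⊗≫
          a ◁ ((hb.β (c ⊗ x)).hom ≫ v₁ ▷ b) ▷ (e ⊗ y) ⊗≫ a ◁ x' ◁ b ◁ v₂ ⊗≫ 𝟙 _ := by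
        rw [← hm]; monoidal
    _ = 𝟙 _ ⊗≫ a ◁ b ◁ c ◁ (he.β x).hom ▷ y ⊗≫ a ◁ b ◁ v₁ ▷ (e ⊗ y) ⊗≫
          a ◁ ((hb.β x').hom ▷ (e ⊗ y) ≫ (x' ⊗ b) ◁ v₂) ⊗≫ 𝟙 _ := by
        rw [← hn]; monoidal
    _ = _ := by
        rw [← whisker_exchange, MonoidalCategory.tensorHom_def]; monoidal

lemma middle_assoc {a b c x y z : C} (hb : HalfBraiding b) (hc : HalfBraiding c) :
    (α_ a b c).hom ▷ ((x ⊗ y) ⊗ z) ≫ (a ⊗ (b ⊗ c)) ◁ (α_ x y z).hom ≫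
      middle a ((α_ _ _ _).hom ≫ b ◁ (hc.β x).hom ≫ (α_ _ _ _).inv ≫ (hb.β x).hom ▷ c ≫
        (α_ _ _ _).hom) (y ⊗ z) ≫ (a ⊗ x) ◁ middle b (hc.β y).hom z =
    middle (a ⊗ b) (hc.β (x ⊗ y)).hom z ≫ middle a (hb.β x).hom y ▷ (c ⊗ z) ≫
      (α_ _ _ _).hom := by
  rw [hc.monoidal]
  simp only [middle]
  calc
    _ = 𝟙 _ ⊗≫ a ◁ b ◁ (hc.β x).hom ▷ y ▷ z ⊗≫
          a ◁ ((hb.β x).hom ▷ (c ⊗ y) ≫ (x ⊗ b) ◁ (hc.β y).hom) ▷ z ⊗≫ 𝟙 _ := by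
        monoidal
    _ = _ := by
        rw [← whisker_exchange]; monoidal

end Coherence

section Canonical

open Functor.OplaxMonoidal

/-- An oplax monoidal functor between braided monoidal categories is braided if its structure
morphisms `F (X ⊗ Y) ⟶ F X ⊗ F Y` intertwine the braidings.  The braiding of the source is an
explicit argument. -/
def IsOplaxBraided {D : Type u₁} [Category.{v₁} D] [MonoidalCategory D] (b : BraidedCategory D)
    {E : Type u₂} [Category.{v₂} E] [MonoidalCategory E] [BraidedCategory E]
    (F : D ⥤ E) [F.OplaxMonoidal] : Prop :=
  ∀ X Y : D, δ F X Y ≫ (β_ (F.obj X) (F.obj Y)).hom = F.map (b.braiding X Y).hom ≫ δ F Y X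

/-- A braided oplax monoidal functor `ψ` to the Drinfeld center of `C` from `B` with the reversed
braiding `c̄_{x,y} = c_{y,x}⁻¹`, such that `ψ 𝟙 ⟶ 𝟙` is an isomorphism, together with internal homs:
for every `x` a right adjoint `[x, -] : C ⥤ B` of `φ(-) ⊗ x`, where `φ` is `ψ` followed by the
forgetful functor. -/
structure CanonicalData (B : Type u₁) [Category.{v₁} B] [MonoidalCategory B] [BraidedCategory B]
    (C : Type u₂) [Category.{v₂} C] [MonoidalCategory C] where
  ψ : B ⥤ Center C
  [oplax : ψ.OplaxMonoidal]
  braided : IsOplaxBraided (reverseBraiding B) ψ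
  [unit_iso : IsIso (η ψ)]
  ihom : C → C ⥤ B
  adj (x : C) : (ψ ⋙ Center.forget C) ⋙ tensorRight x ⊣ ihom x

attribute [instance] CanonicalData.oplax CanonicalData.unit_iso

namespace CanonicalData

variable {B : Type u₁} [Category.{v₁} B] [MonoidalCategory B] [BraidedCategory B]
variable {C : Type u₂} [Category.{v₂} C] [MonoidalCategory C] (D : CanonicalData B C)

/-- The functor `φ : B ⥤ C` underlying `ψ`. -/
def φ : B ⥤ C := D.ψ ⋙ Center.forget C

instance : D.φ.OplaxMonoidal := inferInstanceAs (D.ψ ⋙ Center.forget C).OplaxMonoidal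

/-- The half-braiding of `φ w`. -/
def hb (w : B) : HalfBraiding (D.φ.obj w) := (D.ψ.obj w).2

lemma δ_eq (u v : B) : δ D.φ u v = (δ D.ψ u v).f :=
  Category.comp_id (δ D.ψ u v).f

lemma η_eq : η D.φ = (η D.ψ).f :=
  Category.comp_id (η D.ψ).f

instance : IsIso (η D.φ) := by
  rw [η_eq]
  exact inferInstanceAs (IsIso ((Center.forget C).map (η D.ψ)))

lemma hb_natural {u v : B} (f : u ⟶ v) (x : C) :
    D.φ.map f ▷ x ≫ ((D.hb v).β x).hom = ((D.hb u).β x).hom ≫ x ◁ D.φ.map f :=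
  (D.ψ.map f).comm x

lemma hb_δ (u v : B) (x : C) :
    δ D.φ u v ▷ x ≫ (α_ _ _ _).hom ≫ D.φ.obj u ◁ ((D.hb v).β x).hom ≫ (α_ _ _ _).inv ≫
      ((D.hb u).β x).hom ▷ D.φ.obj v ≫ (α_ _ _ _).hom =
      ((D.hb (u ⊗ v)).β x).hom ≫ x ◁ δ D.φ u v := by
  rw [δ_eq]
  exact (δ D.ψ u v).comm x

lemma hb_η (x : C) : η D.φ ▷ x ≫ (λ_ x).hom ≫ (ρ_ x).inv =
    ((D.hb (𝟙_ B)).β x).hom ≫ x ◁ η D.φ := by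
  rw [η_eq]
  exact (η D.ψ).comm x

lemma hb_braided (u v : B) :
    δ D.φ u v ≫ ((D.hb u).β (D.φ.obj v)).hom = D.φ.map (β_ v u).inv ≫ δ D.φ v u := by
  rw [δ_eq, δ_eq]
  exact congrArg Center.Hom.f (D.braided u v)

/-- The internal hom `[x, y]`. -/
def hom (x y : C) : B := (D.ihom x).obj y

/-- The morphism `φ w ⊗ x ⟶ y` that corresponds to `w ⟶ [x, y]`. -/
def unc {w : B} {x y : C} (f : w ⟶ D.hom x y) : D.φ.obj w ⊗ x ⟶ y :=
  ((D.adj x).homEquiv w y).symm f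

/-- The morphism `w ⟶ [x, y]` that corresponds to `φ w ⊗ x ⟶ y`. -/
def cur {w : B} {x y : C} (f : D.φ.obj w ⊗ x ⟶ y) : w ⟶ D.hom x y :=
  (D.adj x).homEquiv w y f

@[simp]
lemma unc_cur {w : B} {x y : C} (f : D.φ.obj w ⊗ x ⟶ y) : D.unc (D.cur f) = f :=
  ((D.adj x).homEquiv w y).symm_apply_apply f

@[simp]
lemma cur_unc {w : B} {x y : C} (f : w ⟶ D.hom x y) : D.cur (D.unc f) = f :=
  ((D.adj x).homEquiv w y).apply_symm_apply f

lemma unc_injective {w : B} {x y : C} {f g : w ⟶ D.hom x y} (h : D.unc f = D.unc g) : f = g :=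
  ((D.adj x).homEquiv w y).symm.injective h

lemma unc_comp {w w' : B} {x y : C} (g : w' ⟶ w) (f : w ⟶ D.hom x y) :
    D.unc (g ≫ f) = D.φ.map g ▷ x ≫ D.unc f :=
  (D.adj x).homEquiv_naturality_left_symm g f

/-- The evaluation `φ [x, y] ⊗ x ⟶ y`, the counit of the adjunction. -/
def ev (x y : C) : D.φ.obj (D.hom x y) ⊗ x ⟶ y := (D.adj x).counit.app y

lemma unc_eq {w : B} {x y : C} (f : w ⟶ D.hom x y) : D.unc f = D.φ.map f ▷ x ≫ D.ev x y :=
  (D.adj x).homEquiv_counit _ _ f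

lemma unc_id (x y : C) : D.unc (𝟙 (D.hom x y)) = D.ev x y := by
  simp [unc_eq]

/-- The identity `𝟙 ⟶ [x, x]`. -/
def idHom (x : C) : 𝟙_ B ⟶ D.hom x x := D.cur (η D.φ ▷ x ≫ (λ_ x).hom)

/-- The composition `[y, z] ⊗ [x, y] ⟶ [x, z]`. -/
def compHom (x y z : C) : D.hom y z ⊗ D.hom x y ⟶ D.hom x z :=
  D.cur (δ D.φ _ _ ▷ x ≫ (α_ _ _ _).hom ≫ D.φ.obj (D.hom y z) ◁ D.ev x y ≫ D.ev y z)

/-- The tensor product `[x, x'] ⊗ [y, y'] ⟶ [x ⊗ y, x' ⊗ y']`. -/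
def tensHom (x x' y y' : C) : D.hom x x' ⊗ D.hom y y' ⟶ D.hom (x ⊗ y) (x' ⊗ y') :=
  D.cur (δ D.φ _ _ ▷ (x ⊗ y) ≫ middle _ ((D.hb (D.hom y y')).β x).hom _ ≫
    (D.ev x x' ⊗ₘ D.ev y y'))

lemma unc_compHom {u v : B} {x y z : C} (f : u ⟶ D.hom y z) (g : v ⟶ D.hom x y) :
    D.unc ((f ⊗ₘ g) ≫ D.compHom x y z) =
      δ D.φ u v ▷ x ≫ (α_ _ _ _).hom ≫ D.φ.obj u ◁ D.unc g ≫ D.unc f := by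
  rw [unc_comp, compHom, unc_cur, ← comp_whiskerRight_assoc]
  have h : D.φ.map (f ⊗ₘ g) ≫ δ D.φ _ _ = δ D.φ u v ≫ (D.φ.map f ⊗ₘ D.φ.map g) :=
    (δ_natural D.φ f g).symm
  rw [h, unc_eq, unc_eq, MonoidalCategory.tensorHom_def']
  calc
    _ = δ D.φ u v ▷ x ⊗≫ D.φ.obj u ◁ D.φ.map g ▷ x ⊗≫
        (D.φ.map f ▷ (D.φ.obj (D.hom x y) ⊗ x) ≫ D.φ.obj (D.hom y z) ◁ D.ev x y) ⊗≫
          D.ev y z := by monoidal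
    _ = _ := by rw [← whisker_exchange]; monoidal

lemma unc_tensHom {u v : B} {x x' y y' : C} (f : u ⟶ D.hom x x') (g : v ⟶ D.hom y y') :
    D.unc ((f ⊗ₘ g) ≫ D.tensHom x x' y y') =
      δ D.φ u v ▷ (x ⊗ y) ≫ middle _ ((D.hb v).β x).hom _ ≫ (D.unc f ⊗ₘ D.unc g) := by
  rw [unc_comp, tensHom, unc_cur, ← comp_whiskerRight_assoc]
  have h : D.φ.map (f ⊗ₘ g) ≫ δ D.φ _ _ = δ D.φ u v ≫ (D.φ.map f ⊗ₘ D.φ.map g) :=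
    (δ_natural D.φ f g).symm
  have h' := middle_natural (D.φ.map f) (D.φ.map g) _ _ (D.hb_natural g x) y
  rw [h, comp_whiskerRight_assoc, reassoc_of% h', unc_eq, unc_eq, tensorHom_comp_tensorHom]

/-- The enriched category with hom objects `[x, y]`. -/
def enriched : ECat B C where
  hom := D.hom
  id := D.idHom
  comp := D.compHom
  comp_id x y := by
    apply D.unc_injective
    have h := D.unc_compHom (𝟙 (D.hom x y)) (D.idHom x)
    rw [id_tensorHom] at h
    rw [unc_comp, h, idHom, unc_cur, MonoidalCategory.whiskerLeft_comp_assoc,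
      ← associator_naturality_middle_assoc, ← comp_whiskerRight_assoc, ← comp_whiskerRight_assoc,
      Category.assoc, ← oplax_right_unitality]
    monoidal
  id_comp x y := by
    apply D.unc_injective
    have h := D.unc_compHom (D.idHom y) (𝟙 (D.hom x y))
    rw [tensorHom_id] at h
    rw [unc_comp, h, idHom, unc_cur, whisker_exchange_assoc,
      ← associator_naturality_left_assoc, ← comp_whiskerRight_assoc, ← comp_whiskerRight_assoc,
      Category.assoc, ← oplax_left_unitality]
    monoidal
  assoc x y z w := by
    apply D.unc_injective
    have h1 := D.unc_compHom (𝟙 (D.hom z w)) (D.compHom x y z)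
    have h2 := D.unc_compHom (D.compHom y z w) (𝟙 (D.hom x y))
    rw [id_tensorHom] at h1
    rw [tensorHom_id] at h2
    rw [h1, unc_comp, h2, compHom, unc_cur, compHom, unc_cur, unc_id, unc_id]
    have h3 : D.φ.map (α_ (D.hom z w) (D.hom y z) (D.hom x y)).inv ≫ δ D.φ _ _ ≫
        δ D.φ _ _ ▷ _ = δ D.φ _ _ ≫ _ ◁ δ D.φ _ _ ≫ (α_ _ _ _).inv := by
      rw [← cancel_mono (α_ _ _ _).hom, ← cancel_epi (D.φ.map (α_ _ _ _).hom)]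
      simp only [Category.assoc, Iso.inv_hom_id, Category.comp_id, oplax_associativity]
      rw [← D.φ.map_comp_assoc, Iso.hom_inv_id, D.φ.map_id, Category.id_comp]
    rw [whisker_exchange_assoc, ← associator_naturality_left_assoc, ← comp_whiskerRight_assoc,
      ← comp_whiskerRight_assoc, Category.assoc, h3]
    monoidal

lemma unc_whiskR {u : B} {x x' : C} (f : u ⟶ D.hom x x') (y : C) :
    D.unc ((ρ_ u).inv ≫ (f ⊗ₘ D.idHom y) ≫ D.tensHom x x' y y) =
      (α_ _ _ _).inv ≫ D.unc f ▷ y := by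
  have e : D.φ.map (ρ_ u).inv ≫ δ D.φ u (𝟙_ B) ≫ D.φ.obj u ◁ η D.φ = (ρ_ _).inv :=
    (oplax_right_unitality D.φ u).symm
  have h := D.hb_η x
  have hm := middle_natural (𝟙 (D.φ.obj u)) (η D.φ) _ ((λ_ x).hom ≫ (ρ_ x).inv) h y
  rw [unc_comp, unc_tensHom, idHom, unc_cur]
  have e2 : D.unc f ⊗ₘ (η D.φ ▷ y ≫ (λ_ y).hom) =
      (𝟙 (D.φ.obj u) ▷ x ⊗ₘ η D.φ ▷ y) ≫ (D.unc f ⊗ₘ (λ_ y).hom) := by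
    rw [tensorHom_comp_tensorHom, id_whiskerRight, Category.id_comp]
  rw [e2, ← reassoc_of% hm, id_tensorHom, ← comp_whiskerRight_assoc, ← comp_whiskerRight_assoc,
    Category.assoc, e, MonoidalCategory.tensorHom_def', middle]
  monoidal

lemma unc_whiskL {v : B} {y y' : C} (x : C) (g : v ⟶ D.hom y y') :
    D.unc ((λ_ v).inv ≫ (D.idHom x ⊗ₘ g) ≫ D.tensHom x x y y') =
      (α_ _ _ _).inv ≫ ((D.hb v).β x).hom ▷ y ≫ (α_ _ _ _).hom ≫ x ◁ D.unc g := by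
  have e : D.φ.map (λ_ v).inv ≫ δ D.φ (𝟙_ B) v ≫ η D.φ ▷ D.φ.obj v = (λ_ _).inv :=
    (oplax_left_unitality D.φ v).symm
  have hm := middle_natural (η D.φ) (𝟙 (D.φ.obj v)) ((D.hb v).β x).hom ((D.hb v).β x).hom
    (by simp) y
  rw [unc_comp, unc_tensHom, idHom, unc_cur]
  have e2 : (η D.φ ▷ x ≫ (λ_ x).hom) ⊗ₘ D.unc g =
      (η D.φ ▷ x ⊗ₘ 𝟙 (D.φ.obj v) ▷ y) ≫ ((λ_ x).hom ⊗ₘ D.unc g) := by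
    rw [tensorHom_comp_tensorHom, id_whiskerRight, Category.id_comp]
  rw [e2, ← reassoc_of% hm, tensorHom_id, ← comp_whiskerRight_assoc, ← comp_whiskerRight_assoc,
    Category.assoc, e, MonoidalCategory.tensorHom_def, middle]
  monoidal

lemma tensHom_id (x y : C) :
    ((λ_ (𝟙_ B)).inv ≫ (D.idHom x ⊗ₘ D.idHom y)) ≫ D.tensHom x x y y = D.idHom (x ⊗ y) := by
  apply D.unc_injective
  rw [unitors_inv_equal, Category.assoc, unc_whiskR, idHom, idHom, unc_cur, unc_cur]
  monoidal

lemma tensHom_comp (x x' x'' y y' y'' : C) :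
    (interchange _ _ _ _ ≫ (D.compHom x x' x'' ⊗ₘ D.compHom y y' y'')) ≫ D.tensHom x x'' y y'' =
      (D.tensHom x' x'' y' y'' ⊗ₘ D.tensHom x x' y y') ≫ D.compHom _ _ _ := by
  apply D.unc_injective
  have hd := δ_middle D.φ (D.hom x' x'') (D.hom y y') (β_ (D.hom x x') (D.hom y' y'')).inv _
    (D.hb_braided (D.hom y' y'') (D.hom x x'))
  have hm := middle_natural (δ D.φ (D.hom x' x'') (D.hom x x'))
    (δ D.φ (D.hom y' y'') (D.hom y y')) _ _ (D.hb_δ (D.hom y' y'') (D.hom y y') x) y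
  have hk := middle_comp (D.hb (D.hom y' y'')) (D.hb (D.hom y y')) (D.ev x x') (D.ev y y')
    (D.ev x' x'') (D.ev y' y'')
  rw [unc_compHom, Category.assoc, unc_comp, unc_tensHom]
  rw [compHom, compHom, tensHom, tensHom, unc_cur, unc_cur, unc_cur, unc_cur,
    ← tensorHom_comp_tensorHom, ← reassoc_of% hm, ← comp_whiskerRight_assoc,
    ← comp_whiskerRight_assoc, Category.assoc]
  change (D.φ.map (middle _ _ _) ≫ _) ▷ _ ≫ _ = _
  rw [hd, comp_whiskerRight_assoc, comp_whiskerRight_assoc, hk]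
  rw [MonoidalCategory.tensorHom_def]
  simp only [comp_whiskerRight, MonoidalCategory.whiskerLeft_comp, Category.assoc,
    whisker_exchange_assoc]
  monoidal

/-- The tensor product as an enriched functor. -/
def tensor : EFunctor (D.enriched.prod D.enriched) D.enriched where
  obj p := p.1 ⊗ p.2
  map p q := D.tensHom p.1 q.1 p.2 q.2
  map_id p := D.tensHom_id p.1 p.2
  map_comp p q r := D.tensHom_comp p.1 q.1 r.1 p.2 q.2 r.2

/-- The morphism `x ⟶ y` of `C` that corresponds to `𝟙 ⟶ [x, y]`. -/
def toC {x y : C} (f : 𝟙_ B ⟶ D.hom x y) : x ⟶ y :=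
  (λ_ x).inv ≫ inv (η D.φ) ▷ x ≫ D.unc f

/-- The morphism `𝟙 ⟶ [x, y]` that corresponds to `x ⟶ y`. -/
def ofC {x y : C} (g : x ⟶ y) : 𝟙_ B ⟶ D.hom x y :=
  D.cur (η D.φ ▷ x ≫ (λ_ x).hom ≫ g)

lemma unc_toC {x y : C} (f : 𝟙_ B ⟶ D.hom x y) :
    D.unc f = η D.φ ▷ x ≫ (λ_ x).hom ≫ D.toC f := by
  rw [toC, Iso.hom_inv_id_assoc, ← comp_whiskerRight_assoc, IsIso.hom_inv_id, id_whiskerRight,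
    Category.id_comp]

@[simp]
lemma toC_ofC {x y : C} (g : x ⟶ y) : D.toC (D.ofC g) = g := by
  rw [toC, ofC, unc_cur, ← comp_whiskerRight_assoc, IsIso.inv_hom_id, id_whiskerRight,
    Category.id_comp, Iso.inv_hom_id_assoc]

@[simp]
lemma ofC_toC {x y : C} (f : 𝟙_ B ⟶ D.hom x y) : D.ofC (D.toC f) = f := by
  apply D.unc_injective
  rw [ofC, unc_cur, ← unc_toC]

lemma toC_injective {x y : C} {f g : 𝟙_ B ⟶ D.hom x y} (h : D.toC f = D.toC g) : f = g := by
  rw [← D.ofC_toC f, h, ofC_toC]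

@[simp]
lemma toC_id (x : C) : D.toC (D.idHom x) = 𝟙 x := by
  have : D.idHom x = D.ofC (𝟙 x) := by rw [idHom, ofC, Category.comp_id]
  rw [this, toC_ofC]

/-- `D.enriched.postcomp`, with hom objects written as `D.hom`. -/
def postc {y z : C} (f : 𝟙_ B ⟶ D.hom y z) (x : C) : D.hom x y ⟶ D.hom x z :=
  D.enriched.postcomp f x

/-- `D.enriched.precomp`, with hom objects written as `D.hom`. -/
def prec {x y : C} (f : 𝟙_ B ⟶ D.hom x y) (z : C) : D.hom y z ⟶ D.hom x z :=
  D.enriched.precomp f z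

lemma unc_postcomp {u : B} {x y z : C} (a : u ⟶ D.hom x y) (f : 𝟙_ B ⟶ D.hom y z) :
    D.unc (a ≫ D.postc f x) = D.unc a ≫ D.toC f := by
  have h := D.unc_compHom f a
  have e : D.φ.map (λ_ u).inv ≫ δ D.φ (𝟙_ B) u ≫ η D.φ ▷ D.φ.obj u = (λ_ _).inv :=
    (oplax_left_unitality D.φ u).symm
  have e1 : a ≫ D.postc f x = (λ_ u).inv ≫ (f ⊗ₘ a) ≫ D.compHom x y z := by
    rw [MonoidalCategory.tensorHom_def', Category.assoc, id_whiskerLeft_assoc]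
    simp only [Iso.inv_hom_id_assoc]
    rfl
  rw [e1, unc_comp, h, D.unc_toC f, whisker_exchange_assoc, ← associator_naturality_left_assoc,
    ← comp_whiskerRight_assoc, ← comp_whiskerRight_assoc, Category.assoc, e]
  monoidal

lemma unc_precomp {u : B} {x y z : C} (a : u ⟶ D.hom y z) (f : 𝟙_ B ⟶ D.hom x y) :
    D.unc (a ≫ D.prec f z) = D.φ.obj u ◁ D.toC f ≫ D.unc a := by
  have h := D.unc_compHom a f
  have e : D.φ.map (ρ_ u).inv ≫ δ D.φ u (𝟙_ B) ≫ D.φ.obj u ◁ η D.φ = (ρ_ _).inv :=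
    (oplax_right_unitality D.φ u).symm
  have e1 : a ≫ D.prec f z = (ρ_ u).inv ≫ (a ⊗ₘ f) ≫ D.compHom x y z := by
    rw [MonoidalCategory.tensorHom_def, Category.assoc, whiskerRight_id_assoc]
    simp only [Iso.inv_hom_id_assoc]
    rfl
  rw [e1, unc_comp, h, D.unc_toC f, MonoidalCategory.whiskerLeft_comp_assoc,
      ← associator_naturality_middle_assoc, ← comp_whiskerRight_assoc, ← comp_whiskerRight_assoc,
      Category.assoc, e]
  monoidal

lemma toC_ucomp {x y z : C} (f : 𝟙_ B ⟶ D.hom x y) (g : 𝟙_ B ⟶ D.hom y z) :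
    D.toC (D.enriched.ucomp f g) = D.toC f ≫ D.toC g := by
  have h : D.enriched.ucomp f g = f ≫ D.postc g x := ECat.ucomp_eq_postcomp _ _ _
  rw [h]
  change (λ_ x).inv ≫ inv (η D.φ) ▷ x ≫ D.unc (f ≫ D.postc g x) = _
  rw [unc_postcomp]
  simp only [toC, Category.assoc]

lemma toC_tensHom {x x' y y' : C} (f : 𝟙_ B ⟶ D.hom x x') (g : 𝟙_ B ⟶ D.hom y y') :
    D.toC ((λ_ (𝟙_ B)).inv ≫ (f ⊗ₘ g) ≫ D.tensHom x x' y y') = D.toC f ⊗ₘ D.toC g := by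
  have hg : D.unc g = D.unc (D.idHom y) ≫ D.toC g := by
    rw [D.unc_toC g, D.unc_toC (D.idHom y), toC_id]
    simp
  have h1 : D.unc ((λ_ (𝟙_ B)).inv ≫ (f ⊗ₘ g) ≫ D.tensHom x x' y y') =
      D.unc ((ρ_ (𝟙_ B)).inv ≫ (f ⊗ₘ D.idHom y) ≫ D.tensHom x x' y y) ≫ x' ◁ D.toC g := by
    have e : D.unc f ⊗ₘ D.unc g = (D.unc f ⊗ₘ D.unc (D.idHom y)) ≫ x' ◁ D.toC g := by
      rw [hg, ← id_tensorHom, tensorHom_comp_tensorHom, Category.comp_id]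
    rw [unitors_inv_equal, D.unc_comp (ρ_ (𝟙_ B)).inv ((f ⊗ₘ g) ≫ _),
      D.unc_comp (ρ_ (𝟙_ B)).inv ((f ⊗ₘ D.idHom y) ≫ _), unc_tensHom, unc_tensHom, e]
    simp only [Category.assoc]
  have hf : D.toC f = (λ_ x).inv ≫ inv (η D.φ) ▷ x ≫ D.unc f := rfl
  rw [toC, h1, unc_whiskR, MonoidalCategory.tensorHom_def, hf]
  monoidal

lemma toC_map₂ {x x' y y' : C} (f : 𝟙_ B ⟶ D.hom x x') (g : 𝟙_ B ⟶ D.hom y y') :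
    D.toC (D.tensor.map₂ f g) = D.toC f ⊗ₘ D.toC g :=
  D.toC_tensHom f g

/-- The isomorphism in the underlying category given by an isomorphism in `C`. -/
def isoOf {x y : C} (i : x ≅ y) : (⟨x⟩ : D.enriched.Underlying) ≅ ⟨y⟩ where
  hom := D.ofC i.hom
  inv := D.ofC i.inv
  hom_inv_id := by
    apply D.toC_injective
    change D.toC (D.enriched.ucomp _ _) = D.toC (D.idHom x)
    simp [toC_ucomp]
  inv_hom_id := by
    apply D.toC_injective
    change D.toC (D.enriched.ucomp _ _) = D.toC (D.idHom y)
    simp [toC_ucomp]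

lemma hb_unit {x : C} (b : HalfBraiding x) : (b.β (𝟙_ C)).hom = (ρ_ x).hom ≫ (λ_ x).inv := by
  have hn : x ◁ (λ_ (𝟙_ C)).hom ≫ (b.β (𝟙_ C)).hom = (b.β (𝟙_ C ⊗ 𝟙_ C)).hom ≫
      (λ_ (𝟙_ C)).hom ▷ x := b.naturality _
  rw [b.monoidal] at hn
  have key : (ρ_ x).inv ≫ (b.β (𝟙_ C)).hom ≫ (λ_ x).hom = 𝟙 x := by
    have hi : IsIso ((ρ_ x).inv ≫ (b.β (𝟙_ C)).hom ≫ (λ_ x).hom) := inferInstance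
    rw [← cancel_mono ((ρ_ x).inv ≫ (b.β (𝟙_ C)).hom ≫ (λ_ x).hom), Category.id_comp]
    have h := congrArg (fun t => (ρ_ x).inv ≫ x ◁ (λ_ (𝟙_ C)).inv ≫ t ≫ (λ_ x).hom) hn
    have e1 : (ρ_ x).inv ≫ x ◁ (λ_ (𝟙_ C)).inv ≫
        (x ◁ (λ_ (𝟙_ C)).hom ≫ (b.β (𝟙_ C)).hom) ≫ (λ_ x).hom =
        (ρ_ x).inv ≫ (b.β (𝟙_ C)).hom ≫ (λ_ x).hom := by monoidal
    refine Eq.trans ?_ (h.symm.trans e1)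
    monoidal
  rw [← cancel_epi (ρ_ x).inv, ← cancel_mono (λ_ x).hom]
  simpa using key

lemma leftUnitor_square (x y : C) :
    D.prec (D.ofC (λ_ x).hom) y = ((λ_ (D.hom x y)).inv ≫ (D.idHom (𝟙_ C) ⊗ₘ 𝟙 (D.hom x y)) ≫
      D.tensHom (𝟙_ C) (𝟙_ C) x y) ≫ D.postc (D.ofC (λ_ y).hom) (𝟙_ C ⊗ x) := by
  apply D.unc_injective
  rw [unc_postcomp, unc_whiskL, ← Category.id_comp (D.prec _ _), unc_precomp, toC_ofC, toC_ofC,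
    hb_unit]
  monoidal

lemma rightUnitor_square (x y : C) :
    D.prec (D.ofC (ρ_ x).hom) y = ((ρ_ (D.hom x y)).inv ≫ (𝟙 (D.hom x y) ⊗ₘ D.idHom (𝟙_ C)) ≫
      D.tensHom x y (𝟙_ C) (𝟙_ C)) ≫ D.postc (D.ofC (ρ_ y).hom) (x ⊗ 𝟙_ C) := by
  apply D.unc_injective
  rw [unc_postcomp, unc_whiskR, ← Category.id_comp (D.prec _ _), unc_precomp, toC_ofC, toC_ofC]
  monoidal

lemma associator_square (x y z x' y' z' : C) :
    ((α_ _ _ _).hom ≫ (𝟙 (D.hom x x') ⊗ₘ D.tensHom y y' z z') ≫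
      D.tensHom x x' (y ⊗ z) (y' ⊗ z')) ≫ D.prec (D.ofC (α_ x y z).hom) _ =
    ((D.tensHom x x' y y' ⊗ₘ 𝟙 (D.hom z z')) ≫ D.tensHom (x ⊗ y) (x' ⊗ y') z z') ≫
      D.postc (D.ofC (α_ x' y' z').hom) _ := by
  apply D.unc_injective
  have ho := oplax_associativity D.φ (D.hom x x') (D.hom y y') (D.hom z z')
  have hma := middle_assoc (a := D.φ.obj (D.hom x x')) (x := x) (y := y) (z := z)
    (D.hb (D.hom y y')) (D.hb (D.hom z z'))
  have hm1 := middle_natural (𝟙 (D.φ.obj (D.hom x x'))) (δ D.φ (D.hom y y') (D.hom z z')) _ _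
    (D.hb_δ (D.hom y y') (D.hom z z') x) (y ⊗ z)
  have hm2 := middle_natural (δ D.φ (D.hom x x') (D.hom y y')) (𝟙 (D.φ.obj (D.hom z z')))
    ((D.hb (D.hom z z')).β (x ⊗ y)).hom ((D.hb (D.hom z z')).β (x ⊗ y)).hom (by simp) z
  rw [unc_postcomp, unc_precomp, toC_ofC, toC_ofC, D.unc_comp (α_ _ _ _).hom, unc_tensHom,
    unc_tensHom, tensHom, tensHom, unc_cur, unc_cur, unc_id, unc_id]
  have e1 : D.ev x x' ⊗ₘ (δ D.φ (D.hom y y') (D.hom z z') ▷ (y ⊗ z) ≫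
      middle _ ((D.hb (D.hom z z')).β y).hom z ≫ (D.ev y y' ⊗ₘ D.ev z z')) =
      (𝟙 (D.φ.obj (D.hom x x')) ▷ x ⊗ₘ δ D.φ (D.hom y y') (D.hom z z') ▷ (y ⊗ z)) ≫
        _ ◁ middle _ ((D.hb (D.hom z z')).β y).hom z ≫
          (D.ev x x' ⊗ₘ (D.ev y y' ⊗ₘ D.ev z z')) := by
    simp only [← id_tensorHom, tensorHom_comp_tensorHom, id_whiskerRight, Category.id_comp]
  have e2 : (δ D.φ (D.hom x x') (D.hom y y') ▷ (x ⊗ y) ≫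
      middle _ ((D.hb (D.hom y y')).β x).hom y ≫ (D.ev x x' ⊗ₘ D.ev y y')) ⊗ₘ D.ev z z' =
      (δ D.φ (D.hom x x') (D.hom y y') ▷ (x ⊗ y) ⊗ₘ 𝟙 (D.φ.obj (D.hom z z')) ▷ z) ≫
        middle _ ((D.hb (D.hom y y')).β x).hom y ▷ _ ≫
          ((D.ev x x' ⊗ₘ D.ev y y') ⊗ₘ D.ev z z') := by
    simp only [← tensorHom_id, tensorHom_comp_tensorHom, id_tensorHom,
      MonoidalCategory.whiskerLeft_id, Category.id_comp]
  rw [e1, e2, ← reassoc_of% hm1, ← reassoc_of% hm2, id_tensorHom, tensorHom_id]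
  simp only [Category.assoc]
  rw [associator_naturality, ← reassoc_of% hma, ← whisker_exchange_assoc, ← whisker_exchange_assoc,
    ← whisker_exchange_assoc]
  simp only [← comp_whiskerRight_assoc, ← ho]

/-- The data of the canonical construction.  The associator and the unitors are those of `C`, under
the identification of morphisms `𝟙 ⟶ [x, y]` with morphisms `x ⟶ y`. -/
def canonicalStruct : MonECatStruct B C where
  toECat := D.enriched
  unit := 𝟙_ C
  tensor := D.tensor
  leftUnitor :=
    { app := fun x => D.isoOf (λ_ x)
      square := fun x y => by
        have h := D.leftUnitor_square x y
        rw [tensorHom_id] at h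
        exact (Category.id_comp _).trans h }
  rightUnitor :=
    { app := fun x => D.isoOf (ρ_ x)
      square := fun x y => by
        have h := D.rightUnitor_square x y
        rw [id_tensorHom] at h
        exact (Category.id_comp _).trans h }
  associator :=
    { app := fun p => D.isoOf (α_ p.1.1 p.1.2 p.2)
      square := fun p q => D.associator_square p.1.1 p.1.2 p.2 q.1.1 q.1.2 q.2 }

/-- The morphism of `C` that corresponds to a morphism of the underlying category. -/
def toHom {X Y : D.canonicalStruct.Underlying} (f : X ⟶ Y) : X.obj ⟶ Y.obj := D.toC f

lemma toHom_injective {X Y : D.canonicalStruct.Underlying} {f g : X ⟶ Y}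
    (h : D.toHom f = D.toHom g) : f = g := D.toC_injective h

lemma toHom_id (X : D.canonicalStruct.Underlying) : D.toHom (𝟙 X) = 𝟙 X.obj := D.toC_id X.obj

lemma toHom_comp {X Y Z : D.canonicalStruct.Underlying} (f : X ⟶ Y) (g : Y ⟶ Z) :
    D.toHom (f ≫ g) = D.toHom f ≫ D.toHom g := D.toC_ucomp f g

lemma toHom_tensorHom {X Y X' Y' : D.canonicalStruct.Underlying} (f : X ⟶ X') (g : Y ⟶ Y') :
    D.toHom (f ⊗ₘ g) = D.toHom f ⊗ₘ D.toHom g := D.toC_map₂ f g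

lemma toHom_associator (X Y Z : D.canonicalStruct.Underlying) :
    D.toHom (α_ X Y Z).hom = (α_ X.obj Y.obj Z.obj).hom := D.toC_ofC _

lemma toHom_leftUnitor (X : D.canonicalStruct.Underlying) :
    D.toHom (λ_ X).hom = (λ_ X.obj).hom := D.toC_ofC _

lemma toHom_rightUnitor (X : D.canonicalStruct.Underlying) :
    D.toHom (ρ_ X).hom = (ρ_ X.obj).hom := D.toC_ofC _

/-- The canonical construction: `C` as a monoidal category enriched over `B`. -/
def canonical : MonECat B C where
  toMonECatStruct := D.canonicalStruct
  pentagon W X Y Z := by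
    apply D.toHom_injective
    simp only [toHom_comp, toHom_tensorHom, toHom_associator, toHom_id]
    have h := MonoidalCategory.pentagon W.obj X.obj Y.obj Z.obj
    rw [← tensorHom_id, ← id_tensorHom] at h
    exact h
  triangle X Y := by
    apply D.toHom_injective
    simp only [toHom_comp, toHom_tensorHom, toHom_associator, toHom_id, toHom_leftUnitor,
      toHom_rightUnitor]
    have h := MonoidalCategory.triangle X.obj Y.obj
    rw [← tensorHom_id, ← id_tensorHom] at h
    exact h

lemma toC_ucomp_eq {x y z : C} {f : 𝟙_ B ⟶ D.hom x y} {g : 𝟙_ B ⟶ D.hom y z} {f' : x ⟶ y}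
    {g' : y ⟶ z} (hf : D.toC f = f') (hg : D.toC g = g') :
    D.toC (D.enriched.ucomp f g) = f' ≫ g' := by
  rw [← hf, ← hg]
  exact D.toC_ucomp f g

lemma toC_whiskR {x y : C} (f : 𝟙_ B ⟶ D.hom x y) (z : C) :
    D.toC (D.tensor.map₂ f (D.idHom z)) = D.toC f ▷ z := by
  rw [← tensorHom_id, ← D.toC_id z]
  exact D.toC_map₂ f (D.idHom z)

lemma toC_whiskL {x y : C} (z : C) (f : 𝟙_ B ⟶ D.hom x y) :
    D.toC (D.tensor.map₂ (D.idHom z) f) = z ◁ D.toC f := by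
  rw [← id_tensorHom, ← D.toC_id z]
  exact D.toC_map₂ (D.idHom z) f

/-- The isomorphism in `C` given by an isomorphism in the underlying category. -/
def isoToC {x y : C} (i : (⟨x⟩ : D.canonical.Underlying) ≅ ⟨y⟩) : x ≅ y where
  hom := D.toC i.hom
  inv := D.toC i.inv
  hom_inv_id := (D.toC_ucomp i.hom i.inv).symm.trans
    ((congrArg D.toC i.hom_inv_id).trans (D.toC_id x))
  inv_hom_id := (D.toC_ucomp i.inv i.hom).symm.trans
    ((congrArg D.toC i.inv_hom_id).trans (D.toC_id y))

/-- The component of an enriched half-braiding as an isomorphism in `C`. -/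
def halfIso {x : C} (b : D.canonical.EHalfBraiding x) (z : C) : x ⊗ z ≅ z ⊗ x :=
  D.isoToC (b.iso.app z)

/-- The half-braiding in `C` given by an enriched half-braiding. -/
def halfBraiding {x : C} (b : D.canonical.EHalfBraiding x) : HalfBraiding x where
  β z := D.halfIso b z
  monoidal y z := by
    refine (congrArg D.toC (b.monoidal ⟨y⟩ ⟨z⟩)).trans ?_
    refine D.toC_ucomp_eq (D.toC_ofC (α_ x y z).inv) ?_
    refine D.toC_ucomp_eq (D.toC_whiskR (b.iso.app y).hom z) ?_
    refine D.toC_ucomp_eq (D.toC_ofC (α_ y x z).hom) ?_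
    exact D.toC_ucomp_eq (D.toC_whiskL y (b.iso.app z).hom) (D.toC_ofC (α_ y z x).inv)
  naturality {y z} f := by
    have h1 : D.toC (D.tensor.map₂ (D.idHom x) (D.ofC f)) = x ◁ f := by
      rw [toC_whiskL, toC_ofC]
    have h2 : D.toC (D.tensor.map₂ (D.ofC f) (D.idHom x)) = f ▷ x := by
      rw [toC_whiskR, toC_ofC]
    exact (D.toC_ucomp_eq h1 rfl).symm.trans
      ((congrArg D.toC (b.toHalfBraiding.naturality (U := ⟨y⟩) (U' := ⟨z⟩) (D.ofC f))).trans
        (D.toC_ucomp_eq rfl h2))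

lemma comparison_comm {X Y : D.canonical.ECenter} (f : 𝟙_ B ⟶ D.canonical.hom X.obj Y.obj)
    (z : C) (h : f ≫ MonECat.ECenter.eqL X Y z = f ≫ MonECat.ECenter.eqR X Y z) :
    D.toC f ▷ z ≫ (D.halfIso Y.braiding z).hom = (D.halfIso X.braiding z).hom ≫ z ◁ D.toC f := by
  have h' := (MonECat.ECenter.comp_eqR X Y z f).symm.trans
    (h.symm.trans (MonECat.ECenter.comp_eqL X Y z f))
  exact (D.toC_ucomp_eq (D.toC_whiskR f z) rfl).symm.trans
    ((congrArg D.toC h').trans (D.toC_ucomp_eq rfl (D.toC_whiskL z f)))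

variable [HasEqualizers B] [HasIntersections B]

/-- The canonical functor from the underlying category of the Drinfeld center of `D.canonical` to
the Drinfeld center of `C`, given by the correspondence between `𝟙 ⟶ [x, y]` and `x ⟶ y`. -/
def comparison : D.canonical.center.Underlying ⥤ Center C where
  obj X := ⟨X.obj.obj, D.halfBraiding X.obj.braiding⟩
  map {X Y} f :=
    { f := D.toC (D.canonical.centerForget.umap f)
      comm := fun z => D.comparison_comm _ z (D.canonical.centerForget_eq X.obj Y.obj f z) }
  map_id X := Center.Hom.ext
    ((congrArg D.toC (D.canonical.centerForget.underlying.map_id X)).trans (D.toC_id X.obj.obj))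
  map_comp f g := Center.Hom.ext
    ((congrArg D.toC (D.canonical.centerForget.underlying.map_comp f g)).trans (D.toC_ucomp _ _))

end CanonicalData

end Canonical

/-- The centralizer of `ψ : D ⥤ E` in the braided category `E`: the objects whose double braidings
with all objects of the essential image of `ψ` are trivial. -/
def centralizer {D : Type u₁} [Category.{v₁} D] {E : Type u₂} [Category.{v₂} E]
    [MonoidalCategory E] [BraidedCategory E] (ψ : D ⥤ E) : ObjectProperty E :=
  fun x => ∀ z, ψ.essImage z → (β_ x z).hom ≫ (β_ z x).hom = 𝟙 (x ⊗ z)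

end EnrichedCenter

end

/-! Everything is read through the adjunction. A morphism `f : w ⟶ [x, y]` is the same as its
adjoint `D.unc f : φ(w) ⊗ x ⟶ y`, and two morphisms out of a hom object agree once they agree after
precomposition with every such `f`. In these terms, tensoring with `y` on the right just tensors the
adjoint with `y` (`unc_tensRight`), whereas tensoring with `x` on the left must first carry `φ(w)`
past `x`, by the half-braiding of `φ(w)` (`unc_tensLeft`). Through this half-braiding `ψ`, and not
only `φ`, enters both claims.

Objects: let `b` be a half-braiding of `x` in `C`, and test its enriched naturality square on `f : w
⟶ [y, z]`. Naturality of `b` in `D.unc f` and its compatibility with `φ(w) ⊗ y` turn the two sides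
into the same composite, except that one side starts with the double braiding `φ(w) ⊗ x ⟶ x ⊗ φ(w) ⟶
φ(w) ⊗ x`. So the squares commute for all `y`, `z` exactly if all these double braidings are trivial
(`square_iff`). Hence enriched half-braidings are the same as half-braidings in `C` whose object of
`Z(C)` centralizes `ψ` (`centralizer_toCenter`, `toCenter_injective`, `exists_toCenter_eq`).

Morphisms: `f : w ⟶ [x, y]` factors through the hom object of the enriched center if and only if it
is equalized for every `z`. Transposed, this says that `D.unc f` intertwines the half-braiding of
`ψ(w) ⊗ x` with that of `y` (`equalizes_iff`), so that it is a morphism `ψ(w) ⊗ x ⟶ y` of `Z(C)`.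
This is the representability in the second claim (`centerHomEquiv`). Fullness in the first claim is
the case `w = 𝟙`, where `ψ(𝟙) ≅ 𝟙`; faithfulness holds because the inclusion of hom objects is a
monomorphism. -/

namespace EnrichedCenter

/-! ### Extensionality, and reduction of the centralizer to values of the functor -/

lemma ENatIso.ext {B : Type u₁} [Category.{v₁} B] [MonoidalCategory B] {O : Type w₁} {P : Type w₂}
    {𝒞 : ECat B O} {𝒟 : ECat B P} {F G : EFunctor 𝒞 𝒟} {ξ ζ : ENatIso F G}
    (h : ∀ x, (ξ.app x).hom = (ζ.app x).hom) : ξ = ζ := by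
  obtain ⟨a, _⟩ := ξ
  obtain ⟨b, _⟩ := ζ
  obtain rfl : a = b := funext fun x => Iso.ext (h x)
  rfl

lemma MonECat.EHalfBraiding.ext {B : Type u₁} [Category.{v₁} B] [MonoidalCategory B]
    [BraidedCategory B] {O : Type w₁} {M : MonECat B O} {x : O} {b b' : M.EHalfBraiding x}
    (h : ∀ z, b.hom z = b'.hom z) : b = b' := by
  obtain ⟨i, _⟩ := b
  obtain ⟨j, _⟩ := b'
  obtain rfl : i = j := ENatIso.ext h
  rfl

/-- To centralize a functor it is enough to centralize its values. -/
lemma centralizer_iff {D : Type u₁} [Category.{v₁} D] {E : Type u₂} [Category.{v₂} E]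
    [MonoidalCategory E] [BraidedCategory E] (ψ : D ⥤ E) (x : E) :
    centralizer ψ x ↔
      ∀ w : D, (β_ x (ψ.obj w)).hom ≫ (β_ (ψ.obj w) x).hom = 𝟙 (x ⊗ ψ.obj w) := by
  refine ⟨fun h w => h _ (ψ.obj_mem_essImage w), fun h z hz => ?_⟩
  obtain ⟨w, ⟨i⟩⟩ := hz
  -- Naturality of the braiding slides `i.hom` through both braidings, so the double braiding with
  -- `z` is conjugate to the one with `ψ w`.
  rw [← cancel_epi (x ◁ i.hom), BraidedCategory.braiding_naturality_right_assoc,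
    BraidedCategory.braiding_naturality_left, reassoc_of% (h w), Category.comp_id]

namespace CanonicalData

open Functor.OplaxMonoidal

variable {B : Type u₁} [Category.{v₁} B] [MonoidalCategory B] [BraidedCategory B]
variable {C : Type u₂} [Category.{v₂} C] [MonoidalCategory C] (D : CanonicalData B C)

/-! ### Whiskering of internal homs and its adjoint form -/

/-- The operation `- ⊗ y` on internal homs. -/
noncomputable def tensRight (x z y : C) : D.hom x z ⟶ D.hom (x ⊗ y) (z ⊗ y) :=
  (D.tensor.fixRight y).map x z

/-- The operation `x ⊗ -` on internal homs. -/
noncomputable def tensLeft (x y y' : C) : D.hom y y' ⟶ D.hom (x ⊗ y) (x ⊗ y') :=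
  (D.tensor.fixLeft x).map y y'

/-- No half-braiding survives here: the factor that passes `x` comes from the identity of `y`, hence
from `φ(𝟙)`, whose half-braiding is trivial by `hb_η`. -/
lemma unc_tensRight {w : B} {x x' : C} (f : w ⟶ D.hom x x') (y : C) :
    D.unc (f ≫ D.tensRight x x' y) = (α_ _ _ _).inv ≫ D.unc f ▷ y := by
  rw [← unc_whiskR, MonoidalCategory.tensorHom_def, Category.assoc,
    ← rightUnitor_inv_naturality_assoc]
  rfl

/-- Here the factor that passes `x` is `φ(w)` itself, so its half-braiding remains. The contrast
with `unc_tensRight` is what makes double braidings appear. -/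
lemma unc_tensLeft {w : B} {y y' : C} (x : C) (f : w ⟶ D.hom y y') :
    D.unc (f ≫ D.tensLeft x y y') =
      (α_ _ _ _).inv ≫ ((D.hb w).β x).hom ▷ y ≫ (α_ _ _ _).hom ≫ x ◁ D.unc f := by
  rw [← unc_whiskL, MonoidalCategory.tensorHom_def', Category.assoc,
    ← leftUnitor_inv_naturality_assoc]
  rfl

/-! ### Enriched naturality and trivial double braidings -/

/-- The square of an enriched natural transformation `x ⊗ - ⟶ - ⊗ x`, for a half-braiding
of `x` in `C`, says that the double braidings of `x` with all `ψ w` are trivial. -/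
lemma square_iff {x : C} (b : HalfBraiding x) :
    (∀ y z, D.tensRight y z x ≫ D.prec (D.ofC (b.β y).hom) (z ⊗ x) =
      D.tensLeft x y z ≫ D.postc (D.ofC (b.β z).hom) (x ⊗ y)) ↔
    ∀ w, ((D.hb w).β x).hom ≫ (b.β (D.φ.obj w)).hom = 𝟙 _ := by
  -- Naturality of `b` moves it across `D.unc f`, and its value on `φ(w) ⊗ y` splits into its values
  -- on `φ(w)` and on `y`. The value on `φ(w)` meets the half-braiding of `φ(w)` and completes a
  -- double braiding.
  have key {w : B} {y z : C} (f : w ⟶ D.hom y z) :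
      D.unc (f ≫ D.tensLeft x y z ≫ D.postc (D.ofC (b.β z).hom) (x ⊗ y)) =
        (α_ _ _ _).inv ≫ (((D.hb w).β x).hom ≫ (b.β (D.φ.obj w)).hom) ▷ y ≫ (α_ _ _ _).hom ≫
          D.φ.obj w ◁ (b.β y).hom ≫ (α_ _ _ _).inv ≫ D.unc f ▷ x := by
    rw [← Category.assoc, unc_postcomp, toC_ofC, unc_tensLeft]
    simp
  have key' {w : B} {y z : C} (f : w ⟶ D.hom y z) :
      D.unc (f ≫ D.tensRight y z x ≫ D.prec (D.ofC (b.β y).hom) (z ⊗ x)) =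
        D.φ.obj w ◁ (b.β y).hom ≫ (α_ _ _ _).inv ≫ D.unc f ▷ x := by
    rw [← Category.assoc, unc_precomp, toC_ofC, unc_tensRight]
  constructor
  · intro h w
    -- The universal test: `y` is the unit and `z = φ(w) ⊗ 𝟙`, with the `f` whose adjoint is the
    -- identity, so nothing hides the double braiding.
    have e := congrArg (fun t => D.unc (D.cur (𝟙 (D.φ.obj w ⊗ 𝟙_ C)) ≫ t)) (h (𝟙_ C) _)
    simp only [key, key', unc_cur, id_whiskerRight, Category.comp_id] at e
    rw [← cancel_mono (α_ (D.φ.obj w) (𝟙_ C) x).hom] at e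
    simp only [Category.assoc, Iso.inv_hom_id, Category.comp_id] at e
    -- All morphisms following the double braiding are invertible and cancel. What is left is the
    -- double braiding tensored with the unit, and `- ⊗ 𝟙` is faithful.
    have e' : (((D.hb w).β x).hom ≫ (b.β (D.φ.obj w)).hom) ▷ 𝟙_ C = 𝟙 _ ▷ 𝟙_ C := by
      rw [← cancel_mono ((α_ _ _ _).hom ≫ D.φ.obj w ◁ (b.β (𝟙_ C)).hom),
        ← cancel_epi (α_ _ _ _).inv, ← e]
      simp
    rwa [whiskerRight_iff] at e'
  · intro h y z
    apply D.unc_injective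
    -- Inserting the identity of `[y, z]` makes it the test morphism `f`, with `w = [y, z]`.
    rw [← Category.id_comp (D.tensRight y z x ≫ _), ← Category.id_comp (D.tensLeft x y z ≫ _),
      key, key', h]
    simp

/-- The centralizer starts the double braiding at `X ⊗ ψ w`, the enriched square at `φ w ⊗ X`. Both
factors are isomorphisms, so either order gives the identity exactly if the two are mutually
inverse. -/
lemma braiding_comp_eq_id_iff (X : Center C) (w : B) :
    (β_ X (D.ψ.obj w)).hom ≫ (β_ (D.ψ.obj w) X).hom = 𝟙 (X ⊗ D.ψ.obj w) ↔
      ((D.hb w).β X.1).hom ≫ (X.2.β (D.φ.obj w)).hom = 𝟙 _ := by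
  have h : (β_ X (D.ψ.obj w)).hom ≫ (β_ (D.ψ.obj w) X).hom = 𝟙 (X ⊗ D.ψ.obj w) ↔
      (X.2.β (D.φ.obj w)).hom ≫ ((D.hb w).β X.1).hom = 𝟙 _ :=
    ⟨fun h => congrArg Center.Hom.f h, fun h => Center.ext _ _ h⟩
  rw [h, Iso.comp_hom_eq_id, ← Iso.hom_comp_eq_id]

lemma centralizer_iff_square (X : Center C) :
    centralizer D.ψ X ↔
      ∀ y z, D.tensRight y z X.1 ≫ D.prec (D.ofC (X.2.β y).hom) (z ⊗ X.1) =
        D.tensLeft X.1 y z ≫ D.postc (D.ofC (X.2.β z).hom) (X.1 ⊗ y) := by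
  rw [centralizer_iff, square_iff]
  exact forall_congr' (D.braiding_comp_eq_id_iff X)

/-! ### The bijection between objects of the enriched center and of the centralizer -/

lemma ofC_halfBraiding {x : C} (b : D.canonical.EHalfBraiding x) (z : C) :
    D.ofC ((D.halfBraiding b).β z).hom = b.hom z :=
  D.ofC_toC _

lemma halfBraiding_injective {x : C} :
    Function.Injective (D.halfBraiding : D.canonical.EHalfBraiding x → HalfBraiding x) := by
  intro b b' h
  refine MonECat.EHalfBraiding.ext fun z => ?_
  rw [← D.ofC_halfBraiding b, h]
  exact D.ofC_halfBraiding b' z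

/-- Puts the square built into an enriched half-braiding in the form to which
`centralizer_iff_square` applies. -/
lemma square_halfBraiding {x : C} (b : D.canonical.EHalfBraiding x) (y z : C) :
    D.tensRight y z x ≫ D.prec (D.ofC ((D.halfBraiding b).β y).hom) (z ⊗ x) =
      D.tensLeft x y z ≫ D.postc (D.ofC ((D.halfBraiding b).β z).hom) (x ⊗ y) := by
  rw [ofC_halfBraiding, ofC_halfBraiding]
  exact b.square y z

/-- A half-braiding in `C` whose components satisfy the enriched naturality square is an enriched
half-braiding. -/
noncomputable def enrichedHalfBraiding {x : C} (b : HalfBraiding x)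
    (h : ∀ y z, D.tensRight y z x ≫ D.prec (D.ofC (b.β y).hom) (z ⊗ x) =
      D.tensLeft x y z ≫ D.postc (D.ofC (b.β z).hom) (x ⊗ y)) : D.canonical.EHalfBraiding x where
  iso :=
    { app := fun z => D.isoOf (b.β z)
      -- The enriched naturality square is `h` by definition; only the tensor compatibility needs to
      -- be transported.
      square := h }
  monoidal U V := by
    -- The correspondence with morphisms of `C` is injective and respects composition, whiskering
    -- and associators, so the condition becomes `b.monoidal`.
    apply D.toC_injective
    refine (D.toC_ofC (b.β (U.obj ⊗ V.obj)).hom).trans ((b.monoidal U.obj V.obj).trans ?_)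
    symm
    refine D.toC_ucomp_eq (D.toC_ofC (α_ x U.obj V.obj).inv) ?_
    refine D.toC_ucomp_eq
      ((D.toC_whiskR _ V.obj).trans (congrArg (· ▷ V.obj) (D.toC_ofC (b.β U.obj).hom))) ?_
    refine D.toC_ucomp_eq (D.toC_ofC (α_ U.obj x V.obj).hom) ?_
    exact D.toC_ucomp_eq
      ((D.toC_whiskL U.obj _).trans (congrArg (U.obj ◁ ·) (D.toC_ofC (b.β V.obj).hom)))
      (D.toC_ofC (α_ U.obj V.obj x).inv)

lemma halfBraiding_enrichedHalfBraiding {x : C} (b : HalfBraiding x)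
    (h : ∀ y z, D.tensRight y z x ≫ D.prec (D.ofC (b.β y).hom) (z ⊗ x) =
      D.tensLeft x y z ≫ D.postc (D.ofC (b.β z).hom) (x ⊗ y)) :
    D.halfBraiding (D.enrichedHalfBraiding b h) = b := by
  -- A half-braiding is determined by its components, since its remaining fields are propositions.
  have e : (D.halfBraiding (D.enrichedHalfBraiding b h)).β = b.β :=
    funext fun z => Iso.ext (D.toC_ofC (b.β z).hom)
  cases b
  cases hb : D.halfBraiding _
  simp_all

/-- The object of the Drinfeld center of `C` under an object of the enriched Drinfeld center. -/
noncomputable def toCenter (X : D.canonical.ECenter) : Center C := ⟨X.obj, D.halfBraiding X.braiding⟩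

lemma centralizer_toCenter (X : D.canonical.ECenter) : centralizer D.ψ (D.toCenter X) :=
  (D.centralizer_iff_square _).2 (D.square_halfBraiding X.braiding)

lemma toCenter_injective : Function.Injective D.toCenter := by
  rintro ⟨x, b⟩ ⟨x', b'⟩ h
  obtain ⟨rfl, h'⟩ := Sigma.mk.inj_iff.1 h
  obtain rfl : b = b' := D.halfBraiding_injective (eq_of_heq h')
  rfl

/-- Centralizing `ψ` supplies exactly the squares that promote the half-braiding of `X` to an
enriched one. The result is an equality of objects, not merely an isomorphism. -/
lemma exists_toCenter_eq {X : Center C} (h : centralizer D.ψ X) : ∃ Y, D.toCenter Y = X :=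
  ⟨⟨X.1, D.enrichedHalfBraiding X.2 ((D.centralizer_iff_square X).1 h)⟩,
    congrArg (Sigma.mk X.1) (D.halfBraiding_enrichedHalfBraiding X.2 _)⟩

/-! ### Hom objects of the enriched center -/

/-- A morphism to `[x, y]` is equalized by the two operations given by half-braidings of `x` and
`y` exactly if its adjoint commutes with the half-braidings. -/
lemma equalizes_iff {w : B} {x y : C} (b : HalfBraiding x) (b' : HalfBraiding y)
    (f : w ⟶ D.hom x y) (z : C) :
    f ≫ D.tensLeft z x y ≫ D.prec (D.ofC (b.β z).hom) (z ⊗ y) =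
        f ≫ D.tensRight x y z ≫ D.postc (D.ofC (b'.β z).hom) (x ⊗ z) ↔
      D.unc f ▷ z ≫ (b'.β z).hom =
        ((α_ _ _ _).hom ≫ D.φ.obj w ◁ (b.β z).hom ≫ (α_ _ _ _).inv ≫
          ((D.hb w).β z).hom ▷ x ≫ (α_ _ _ _).hom) ≫ z ◁ D.unc f := by
  have hL : D.unc (f ≫ D.tensLeft z x y ≫ D.prec (D.ofC (b.β z).hom) (z ⊗ y)) =
      D.φ.obj w ◁ (b.β z).hom ≫ (α_ _ _ _).inv ≫
        ((D.hb w).β z).hom ▷ x ≫ (α_ _ _ _).hom ≫ z ◁ D.unc f := by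
    rw [← Category.assoc, unc_precomp, toC_ofC, unc_tensLeft]
  have hR : D.unc (f ≫ D.tensRight x y z ≫ D.postc (D.ofC (b'.β z).hom) (x ⊗ z)) =
      (α_ _ _ _).inv ≫ D.unc f ▷ z ≫ (b'.β z).hom := by
    rw [← Category.assoc, unc_postcomp, toC_ofC, unc_tensRight, Category.assoc]
  simp only [Category.assoc]
  -- The bracketed composite is the half-braiding of a tensor product in the center. Moving its
  -- leading associator to the other side leaves the adjoints of the two operations.
  rw [← hL, ← Iso.inv_comp_eq, ← hR]
  exact ⟨fun h => by rw [h], fun h => (D.unc_injective h).symm⟩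

lemma eqL_eq (X Y : D.canonical.ECenter) (z : C) :
    MonECat.ECenter.eqL X Y z = D.tensLeft z X.obj Y.obj ≫
      D.prec (D.ofC ((D.halfBraiding X.braiding).β z).hom) (z ⊗ Y.obj) := by
  rw [ofC_halfBraiding]
  rfl

lemma eqR_eq (X Y : D.canonical.ECenter) (z : C) :
    MonECat.ECenter.eqR X Y z = D.tensRight X.obj Y.obj z ≫
      D.postc (D.ofC ((D.halfBraiding Y.braiding).β z).hom) (X.obj ⊗ z) := by
  rw [ofC_halfBraiding]
  rfl

/-- A morphism to `[x, y]` equalizes the two morphisms that define the hom object of the enriched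
Drinfeld center exactly if its adjoint is a morphism in the Drinfeld center of `C`. -/
lemma comp_eqL_eq_comp_eqR_iff (X Y : D.canonical.ECenter) {w : B}
    (f : w ⟶ D.canonical.hom X.obj Y.obj) (z : C) :
    f ≫ MonECat.ECenter.eqL X Y z = f ≫ MonECat.ECenter.eqR X Y z ↔
      D.unc f ▷ z ≫ ((D.toCenter Y).2.β z).hom =
        ((D.ψ.obj w ⊗ D.toCenter X).2.β z).hom ≫ z ◁ D.unc f := by
  -- The half-braiding of `ψ w ⊗ X` in the center unfolds to the bracketed composite in
  -- `equalizes_iff`.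
  rw [eqL_eq, eqR_eq]
  exact D.equalizes_iff (D.halfBraiding X.braiding) (D.halfBraiding Y.braiding) f z

variable [HasEqualizers B] [HasIntersections B]

/-- Morphisms to a hom object of the enriched Drinfeld center are the morphisms in the Drinfeld
center of `C` given by the adjunction. -/
noncomputable def centerHomEquiv (X Y : D.canonical.ECenter) (w : B) :
    (w ⟶ D.canonical.center.hom X Y) ≃ (D.ψ.obj w ⊗ D.toCenter X ⟶ D.toCenter Y) where
  toFun f :=
    { f := D.unc (f ≫ D.canonical.centerForget.map X Y)
      comm := fun z => (D.comp_eqL_eq_comp_eqR_iff X Y _ z).1 (D.canonical.centerForget_eq X Y f z) }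
  invFun g := (MonECat.ECenter.homSub X Y).factorThru (D.cur g.f)
    ((MonECat.ECenter.homSub_factors X Y _).2 fun z => (D.comp_eqL_eq_comp_eqR_iff X Y _ z).2 (by
      have h := g.comm z
      rwa [← D.unc_cur g.f] at h))
  left_inv f := by
    refine (cancel_mono (MonECat.ECenter.ι X Y)).1 ?_
    exact (Subobject.factorThru_arrow _ _ _).trans (D.cur_unc _)
  right_inv g := Center.ext _ _
    ((congrArg D.unc (Subobject.factorThru_arrow _ _ _)).trans (D.unc_cur g.f))

/-- The hom object of the enriched Drinfeld center represents `Z(C)(ψ(-) ⊗ X, Y)`. -/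
noncomputable def centerHomRepresentableBy (X Y : D.canonical.ECenter) :
    ((D.ψ ⋙ tensorRight (D.toCenter X)).op ⋙
      yoneda.obj (D.toCenter Y)).RepresentableBy (D.canonical.center.hom X Y) where
  homEquiv := D.centerHomEquiv X Y _
  homEquiv_comp f g := Center.ext _ _
    ((congrArg D.unc (Category.assoc f g _)).trans (D.unc_comp f _))

/-! ### Full faithfulness of the comparison functor -/

lemma centralizer_comparison (X : D.canonical.center.Underlying) :
    centralizer D.ψ (D.comparison.obj X) :=
  D.centralizer_toCenter X.obj

instance comparison_faithful : D.comparison.Faithful where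
  map_injective {X Y f g} h := by
    exact (cancel_mono (MonECat.ECenter.ι X.obj Y.obj)).1
      (D.toC_injective (congrArg Center.Hom.f h))

instance comparison_full : D.comparison.Full where
  map_surjective {X Y} g := by
    -- To reach `g` from the hom object tested on the unit, `g` is first pulled back along `ψ(𝟙) ⊗ X
    -- ⟶ 𝟙 ⊗ X ≅ X` inside the center.
    let k : D.ψ.obj (𝟙_ B) ⊗ D.toCenter X.obj ⟶ D.toCenter Y.obj :=
      η D.ψ ▷ D.toCenter X.obj ≫ (λ_ _).hom ≫ g
    have hk : k.f = η D.φ ▷ X.obj.obj ≫ (λ_ _).hom ≫ g.f := by rw [η_eq]; rfl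
    refine ⟨(D.centerHomEquiv X.obj Y.obj (𝟙_ B)).symm k, Center.ext _ _ ?_⟩
    have e := congrArg Center.Hom.f ((D.centerHomEquiv X.obj Y.obj (𝟙_ B)).apply_symm_apply k)
    refine Eq.trans ?_ (D.toC_ofC g.f)
    refine congrArg D.toC (D.unc_injective ?_)
    -- Both sides have adjoint `k.f`, which is the adjoint defining `D.ofC g.f`.
    exact e.trans (hk.trans (D.unc_cur _).symm)

end CanonicalData

end EnrichedCenter

theorem mainTheorem4
    {B : Type u₁} [Category.{v₁} B] [MonoidalCategory B] [BraidedCategory B]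
    [HasEqualizers B] [EnrichedCenter.HasIntersections B]
    {C : Type u₂} [Category.{v₂} C] [MonoidalCategory C]
    (D : EnrichedCenter.CanonicalData B C) :
    (∃ h : ∀ X : D.canonical.center.Underlying,
        EnrichedCenter.centralizer D.ψ (D.comparison.obj X),
      ((EnrichedCenter.centralizer D.ψ).lift D.comparison h).Full ∧
      ((EnrichedCenter.centralizer D.ψ).lift D.comparison h).Faithful ∧
      Function.Bijective ((EnrichedCenter.centralizer D.ψ).lift D.comparison h).obj) ∧
    ∀ X Y : D.canonical.ECenter,
      ∃ r : ((D.ψ ⋙ tensorRight (D.comparison.obj ⟨X⟩)).op ⋙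
          yoneda.obj (D.comparison.obj ⟨Y⟩)).RepresentableBy (D.canonical.center.hom X Y),
        ∀ (w : B) (f : w ⟶ D.canonical.center.hom X Y),
          (r.homEquiv f).f = D.unc (f ≫ D.canonical.centerForget.map X Y) := by
  -- `D.comparison.obj ⟨X⟩` is `D.toCenter X` by definition, and the representing bijection is
  -- transposition by construction, so its formula is `rfl`.
  refine ⟨⟨D.centralizer_comparison, inferInstance, inferInstance, ?_, ?_⟩,
    fun X Y => ⟨D.centerHomRepresentableBy X Y, fun _ _ => rfl⟩⟩
  · intro X Y h
    exact EnrichedCenter.ECat.Underlying.ext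
      (D.toCenter_injective (congrArg ObjectProperty.FullSubcategory.obj h))
  · rintro ⟨X, hX⟩
    obtain ⟨Y, rfl⟩ := D.exists_toCenter_eq hX
    exact ⟨⟨Y⟩, rfl⟩
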